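/- Let $p$ be a prime number, let $k$ be a field with separable closure $k_s$, and let $K_1,\dots,K_n\subset k_s$ be cyclic extensions of $k$ whose degrees are positive powers of $p$ (that is, $p^{e}$ with $e\ge 1$) and which are pairwise disjoint: $K_i\cap K_j=k$ for $i\ne j$. Let $(K_i)_{\rm prim}$ be the unique subfield of $K_i$ of degree $p$ over $k$, put $L_{\rm prim}=\prod_{i=1}^n (K_i)_{\rm prim}$, and let $T_{\rm prim}=R^{(1)}_{L_{\rm prim}/k}(\mathbf{G}_m)$ be the norm torus, i.e. the kernel of ${\rm N}_{L_{\rm prim}/k}: R_{L_{\rm prim}/k}(\mathbf{G}_m)\to \mathbf{G}_m$. Let $k'_{\rm prim}\subset k_s$ be a finite Galois extension of $k$ of minimal degree splitting $T_{\rm prim}$, let $G_{\rm prim}={\rm Gal}(k'_{\rm prim}/k)$, and let $\hat T_{\rm prim}$ be the $G_{\rm prim}$-lattice of characters of $T_{\rm prim}$ (defined over $k'_{\rm prim}$). For a finite group $G$ and a $G$-lattice $M$, let $$\mathrm{Sha}^2_{\rm cycl}(G,M)={\rm Ker}\Big[H^2(G,M)\to \prod_{g\in G} H^2(\langle g\rangle,M)\Big],$$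 and let $C_p$ be the cyclic group of order $p$. (a) If $G_{\rm prim}\not\simeq C_p\times C_p$, then $\mathrm{Sha}^2_{\rm cycl}(G_{\rm prim},\hat T_{\rm prim})=0$. (b) If $G_{\rm prim}\simeq C_p\times C_p$, then $n\ge 2$ and $\mathrm{Sha}^2_{\rm cycl}(G_{\rm prim},\hat T_{\rm prim})\simeq (\mathbf{Z}/p\mathbf{Z})^{n-2}$. -/

import Mathlib

open scoped TensorProduct

universe u v w

/-! ### Second cohomology of a group and the cyclic Tate-Shafarevich group -/

section Cohomology

variable (G : Type v) (A : Type w) [Group G] [AddCommGroup A] [DistribMulAction G A]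

/-- The group of (inhomogeneous) 2-cocycles of `G` with values in the `G`-module `A`. -/
def twoCocycles : AddSubgroup (G × G → A) where
  carrier := {f | groupCohomology.IsCocycle₂ f}
  zero_mem' := by intro g h j; simp
  add_mem' := by
    intro a b ha hb g h j
    have h1 := ha g h j
    have h2 := hb g h j
    simp only [Pi.add_apply, smul_add]
    rw [add_add_add_comm, h1, h2, add_add_add_comm]
  neg_mem' := by
    intro a ha g h j
    have h1 := ha g h j
    simp only [Pi.neg_apply, smul_neg]
    rw [← neg_add, h1, neg_add]

/-- The group of (inhomogeneous) 2-coboundaries of `G` with values in the `G`-module `A`. -/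
def twoCoboundaries : AddSubgroup (G × G → A) where
  carrier := {f | groupCohomology.IsCoboundary₂ f}
  zero_mem' := ⟨0, by intro g h; simp⟩
  add_mem' := by
    rintro a b ⟨x, hx⟩ ⟨y, hy⟩
    refine ⟨x + y, fun g h => ?_⟩
    simp only [Pi.add_apply, smul_add]
    rw [← hx, ← hy]
    abel
  neg_mem' := by
    rintro a ⟨x, hx⟩
    refine ⟨-x, fun g h => ?_⟩
    simp only [Pi.neg_apply, smul_neg]
    rw [← hx]
    abel

/-- The second cohomology group `H²(G, A)`: 2-cocycles modulo 2-coboundaries. -/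
abbrev HTwo : Type (max v w) :=
  twoCocycles G A ⧸ (twoCoboundaries G A).addSubgroupOf (twoCocycles G A)

variable {G}

/-- Restriction of 2-cocycles to a subgroup. -/
def resCocycles (H : Subgroup G) : twoCocycles G A →+ twoCocycles H A where
  toFun f := ⟨fun x => f.1 (x.1, x.2), fun g h j => f.2 g h j⟩
  map_zero' := rfl
  map_add' _ _ := rfl

/-- The restriction map `H²(G, A) → H²(H, A)` to a subgroup `H` of `G`. -/
def HTwo.res (H : Subgroup G) : HTwo G A →+ HTwo H A :=
  QuotientAddGroup.map _ _ (resCocycles A H) (by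
    rintro ⟨f, hf⟩ ⟨x, hx⟩
    exact ⟨fun h => x h, fun g h => hx g h⟩)

variable (G)

/-- The cyclic Tate-Shafarevich group: the kernel of
`H²(G, A) → ∏_{g ∈ G} H²(⟨g⟩, A)`. -/
def ShaTwoCycl : AddSubgroup (HTwo G A) :=
  ⨅ g : G, (HTwo.res A (Subgroup.zpowers g)).ker

end Cohomology

/-! ### The norm torus of an étale algebra, through its functor of points -/

section NormTorus

variable (k : Type u) [Field k] (L : Type u) [CommRing L] [Algebra k L]

/-- The base change map `R ⊗ L → S ⊗ L` along a homomorphism of `k`-algebras `φ : R → S`. -/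
noncomputable abbrev baseChangeMap {R S : Type u} [CommRing R] [Algebra k R] [CommRing S]
    [Algebra k S] (φ : R →ₐ[k] S) : R ⊗[k] L →ₐ[k] S ⊗[k] L :=
  Algebra.TensorProduct.map φ (AlgHom.id k L)

/-- The norm of an algebra of finite dimension is compatible with base change. -/
theorem norm_baseChangeMap [Module.Finite k L] {R S : Type u} [CommRing R] [Algebra k R]
    [CommRing S] [Algebra k S] (φ : R →ₐ[k] S) (x : R ⊗[k] L) :
    Algebra.norm S (baseChangeMap k L φ x) = φ (Algebra.norm R x) := by
  classical
  let b := Module.finBasis k L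
  have hrepr : ∀ (y : R ⊗[k] L) (i), (b.baseChange S).repr (baseChangeMap k L φ y) i =
      φ ((b.baseChange R).repr y i) := by
    intro y i
    induction y using TensorProduct.induction_on with
    | zero => simp
    | tmul r l => simp
    | add y z hy hz => simp only [map_add, Finsupp.add_apply, hy, hz]
  rw [Algebra.norm_eq_matrix_det (b.baseChange S), Algebra.norm_eq_matrix_det (b.baseChange R),
    AlgHom.map_det]
  congr 1
  ext i j
  rw [Algebra.leftMulMatrix_eq_repr_mul, AlgHom.mapMatrix_apply, Matrix.map_apply,
    Algebra.leftMulMatrix_eq_repr_mul, ← hrepr]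
  simp

/-- The group of `R`-points of the norm torus `T_{L/k}`, for a `k`-algebra `R`:
the units of `R ⊗ L` of norm `1`. -/
noncomputable def normTorus (R : Type u) [CommRing R] [Algebra k R] : Subgroup (R ⊗[k] L)ˣ :=
  (Units.map (Algebra.norm R : R ⊗[k] L →* R)).ker

variable [Module.Finite k L]

/-- The homomorphism `T_{L/k}(R) → T_{L/k}(S)` induced by a homomorphism of `k`-algebras. -/
noncomputable def normTorusMap {R S : Type u} [CommRing R] [Algebra k R] [CommRing S]
    [Algebra k S] (φ : R →ₐ[k] S) : normTorus k L R →* normTorus k L S :=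
  ((Units.map (baseChangeMap k L φ : R ⊗[k] L →* S ⊗[k] L)).comp
    (normTorus k L R).subtype).codRestrict (normTorus k L S) (by
      rintro ⟨x, hx⟩
      have h1 : Algebra.norm R (x : R ⊗[k] L) = 1 := congrArg Units.val hx
      refine Units.ext ?_
      change Algebra.norm S (baseChangeMap k L φ (x : R ⊗[k] L)) = 1
      rw [norm_baseChangeMap, h1, map_one])

variable (K : Type u) [Field K] [Algebra k K]

/-- A character of the norm torus over a field extension `K` of `k`: a homomorphism
`T_{L/k} ×_k K → 𝔾_m` of group functors on `K`-algebras. A `K`-algebra is given as a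
`k`-algebra `R` together with a `k`-homomorphism `f : K → R`. -/
@[ext]
structure TorusCharacter where
  /-- the homomorphism on points -/
  eval : ∀ (R : Type u) [CommRing R] [Algebra k R], (K →ₐ[k] R) → (normTorus k L R →* Rˣ)
  natural : ∀ (R S : Type u) [CommRing R] [Algebra k R] [CommRing S] [Algebra k S]
    (f : K →ₐ[k] R) (φ : R →ₐ[k] S) (x : normTorus k L R),
    eval S (φ.comp f) (normTorusMap k L φ x) = Units.map (φ : R →* S) (eval R f x)

namespace TorusCharacter

variable {k L K}

noncomputable instance : Zero (TorusCharacter k L K) :=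
  ⟨⟨fun _ _ _ _ => 1, by intros; simp⟩⟩

noncomputable instance : Add (TorusCharacter k L K) :=
  ⟨fun χ ψ => ⟨fun R _ _ f => χ.eval R f * ψ.eval R f, by
    intros; simp only [MonoidHom.mul_apply, map_mul, natural]⟩⟩

noncomputable instance : Neg (TorusCharacter k L K) :=
  ⟨fun χ => ⟨fun R _ _ f => (χ.eval R f)⁻¹, by
    intros; simp only [MonoidHom.inv_apply, map_inv, natural]⟩⟩

/-- The characters form an abelian group (written additively) under pointwise multiplication. -/
noncomputable instance : AddCommGroup (TorusCharacter k L K) where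
  add_assoc χ ψ ξ := by
    ext R _ _ f x
    exact congrArg Units.val (mul_assoc (χ.eval R f x) (ψ.eval R f x) (ξ.eval R f x))
  zero_add χ := by
    ext R _ _ f x
    exact congrArg Units.val (one_mul (χ.eval R f x))
  add_zero χ := by
    ext R _ _ f x
    exact congrArg Units.val (mul_one (χ.eval R f x))
  add_comm χ ψ := by
    ext R _ _ f x
    exact congrArg Units.val (mul_comm (χ.eval R f x) (ψ.eval R f x))
  neg_add_cancel χ := by
    ext R _ _ f x
    exact congrArg Units.val (inv_mul_cancel (χ.eval R f x))
  nsmul := nsmulRec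
  zsmul := zsmulRec

/-- The action of `Gal(K/k)` on the characters over `K`. A `K`-algebra `f : K → R` is sent to its
twist `f ∘ σ`; on `K`-points this is `(σ χ)(x) = σ (χ (σ⁻¹ x))`. -/
noncomputable instance : DistribMulAction (K ≃ₐ[k] K) (TorusCharacter k L K) where
  smul σ χ := ⟨fun R _ _ f => χ.eval R (f.comp (σ : K →ₐ[k] K)), by
    intro R S _ _ _ _ f φ x
    exact χ.natural R S (f.comp (σ : K →ₐ[k] K)) φ x⟩
  one_smul _ := rfl
  mul_smul _ _ _ := rfl
  smul_zero _ := rfl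
  smul_add _ _ _ := rfl

/-- The formula for the Galois action on `K`-points. -/
theorem smul_eval_self (σ : K ≃ₐ[k] K) (χ : TorusCharacter k L K) (x : normTorus k L K) :
    (σ • χ).eval K (AlgHom.id k K) x =
      Units.map (σ : K →* K) (χ.eval K (AlgHom.id k K)
        (normTorusMap k L (σ.symm : K →ₐ[k] K) x)) := by
  have h := χ.natural K K (AlgHom.id k K) (σ : K →ₐ[k] K)
    (normTorusMap k L (σ.symm : K →ₐ[k] K) x)
  have hx : normTorusMap k L (σ : K →ₐ[k] K) (normTorusMap k L (σ.symm : K →ₐ[k] K) x) = x := by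
    apply Subtype.ext
    apply Units.ext
    change baseChangeMap k L (σ : K →ₐ[k] K)
      (baseChangeMap k L (σ.symm : K →ₐ[k] K) (x : (K ⊗[k] L)ˣ).val) = _
    induction (x : (K ⊗[k] L)ˣ).val using TensorProduct.induction_on with
    | zero => simp
    | tmul a l => simp
    | add y z hy hz => rw [map_add, map_add, hy, hz]
  rw [hx] at h
  exact h

end TorusCharacter

/-- An isomorphism `T_{L/k} ×_k K ≃ 𝔾_m^r` of group functors on `K`-algebras. -/
structure TorusSplitting (r : ℕ) where
  /-- the isomorphism on points -/
  equiv : ∀ (R : Type u) [CommRing R] [Algebra k R], (K →ₐ[k] R) → (normTorus k L R ≃* (Fin r → Rˣ))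
  natural : ∀ (R S : Type u) [CommRing R] [Algebra k R] [CommRing S] [Algebra k S]
    (f : K →ₐ[k] R) (φ : R →ₐ[k] S) (x : normTorus k L R) (i : Fin r),
    equiv S (φ.comp f) (normTorusMap k L φ x) i = Units.map (φ : R →* S) (equiv R f x i)

/-- The extension `K` of `k` splits the norm torus `T_{L/k}`. -/
def SplitsNormTorus : Prop :=
  ∃ r : ℕ, Nonempty (TorusSplitting k L K r)

/-- `E` is a finite Galois extension of `k`, inside the given separable closure, that splits
`T_{L/k}` and has minimal degree among all such extensions. -/
structure IsMinimalGaloisSplitting {ks : Type u} [Field ks] [Algebra k ks]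
    (E : IntermediateField k ks) : Prop where
  finite : FiniteDimensional k E
  galois : IsGalois k E
  splits : SplitsNormTorus k L E
  minimal : ∀ F : IntermediateField k ks, FiniteDimensional k F → IsGalois k F →
    SplitsNormTorus k L F → Module.finrank k E ≤ Module.finrank k F

end NormTorus

/-- `K/k` is a cyclic extension whose degree is a power `p ^ e` of `p` with `e ≥ 1`. -/
structure IsCyclicPPower (p : ℕ) (k : Type u) (K : Type u) [Field k] [Field K] [Algebra k K] :
    Prop where
  galois : IsGalois k K
  cyclic : IsCyclic (K ≃ₐ[k] K)
  degree : ∃ e : ℕ, 1 ≤ e ∧ Module.finrank k K = p ^ e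

/-- `P` is a subfield of `K` of degree `p` over `k` (it is unique when `K/k` is cyclic of degree
a positive power of `p`). -/
structure IsPrimPart (p : ℕ) {k ks : Type u} [Field k] [Field ks] [Algebra k ks]
    (K P : IntermediateField k ks) : Prop where
  le : P ≤ K
  degree : Module.finrank k P = p

/-! ### Cohomology of quotients of permutation lattices by the constants -/

/-! Let `G` be the Galois group and let `H i` be the subgroup fixing the `i`-th field of degree `p`.
Over `E` the torus is the locus where the product of the coordinates indexed by the embeddings is 1.
Its character module is therefore `M = ℤ^X/ℤ`, where `X` is the disjoint union of the coset spaces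
`G/H i`. By minimality `E` is the compositum of the degree `p` fields. Hence `G` is abelian of
exponent `p`, and the `H i` are distinct, of index `p`, with trivial intersection.

The sequence `0 → ℤ → ℤ^X → M → 0` and Shapiro's lemma give a map from families `φ i ∈ Hom(H i,
ℚ/ℤ)` to `H²(G, M)`, whose kernel consists of the restrictions of a single homomorphism on `G`. The
obstruction to being in its image lies in `H³(G, ℤ) = H²(G, ℚ/ℤ)`. For a class trivial on cyclic
subgroups this obstruction is a symmetric cocycle, because two of the `H i` generate `G`; it
vanishes because `ℚ/ℤ` is divisible (`exists_coboundary_of_symmetric`). Triviality on cyclic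
subgroups then says exactly that `φ i = φ j` on `H i ∩ H j`. So Sha is the group of compatible
families modulo global homomorphisms (`exists_carryClass_eq_of_mem_shaTwoCycl`,
`carryClass_mem_shaTwoCycl`, `carryClass_eq_zero_iff`). These arguments run on explicit cochains: an
integral 2-cochain is replaced by a rational 1-cochain with that coboundary up to constants, read
modulo `ℤ`.

It remains to count. If two of the `H i` meet nontrivially, every compatible family is global
(`exists_hom_of_compatible`) and Sha is zero. If `G` is `C_p × C_p`, the `H i` are distinct lines,
every family is compatible, and the quotient is `(ℤ/p)^n` modulo the plane `Hom(G, ℤ/p)`. With fewer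
than two fields `G` is cyclic and Sha is trivially zero. -/

section PermutationQuotient

/-- `π` presents the `G`-module `M` as the quotient of the permutation module `ℤ^X` by the
constant functions. -/
structure IsPermutationQuotient (G : Type*) [Group G] {X : Type*} [MulAction G X] {M : Type*}
    [AddCommGroup M] [DistribMulAction G M] (π : (X → ℤ) →+ M) : Prop where
  surjective : Function.Surjective π
  map_translate : ∀ (g : G) (F : X → ℤ), π (fun x => F (g⁻¹ • x)) = g • π F
  map_eq_zero_iff : ∀ F : X → ℤ, π F = 0 ↔ ∀ x y, F x = F y

/-- `B` is a rational 1-cochain whose coboundary is the integral 2-cochain `F` up to constants. -/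
def IsPotential {G X : Type*} [Group G] [MulAction G X] (F : G → G → X → ℤ) (B : G → X → ℚ) :
    Prop :=
  ∀ g h, ∃ c : ℚ, ∀ x, B g x + B h (g⁻¹ • x) - B (g * h) x = F g h x + c

/-- The 1-cochain `B` is integral up to constants and to the coboundary of a rational function. -/
def IsIntegralUpToCoboundary {G X : Type*} [Group G] [MulAction G X] (B : G → X → ℚ) : Prop :=
  ∃ (Z : G → X → ℤ) (t : G → ℚ) (b : X → ℚ), ∀ g x, B g x = Z g x + t g + b x - b (g⁻¹ • x)

variable {G : Type*} [Group G] {X : Type*} [MulAction G X] {M : Type*}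
  [AddCommGroup M] [DistribMulAction G M] {π : (X → ℤ) →+ M}

theorem IsPermutationQuotient.subgroup (hπ : IsPermutationQuotient G π) (S : Subgroup G) :
    IsPermutationQuotient S π :=
  ⟨hπ.surjective, fun g F => hπ.map_translate (g : G) F, hπ.map_eq_zero_iff⟩

theorem IsPermutationQuotient.map_eq_iff (hπ : IsPermutationQuotient G π) (F F' : X → ℤ) :
    π F = π F' ↔ ∃ c : ℤ, ∀ x, F x = F' x + c := by
  rw [← sub_eq_zero, ← map_sub, hπ.map_eq_zero_iff]
  constructor
  · intro h
    rcases isEmpty_or_nonempty X with hX | ⟨⟨x₀⟩⟩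
    · exact ⟨0, fun x => hX.elim x⟩
    · refine ⟨F x₀ - F' x₀, fun x => ?_⟩
      have := h x x₀
      simp only [Pi.sub_apply] at this
      omega
  · rintro ⟨c, hc⟩ x y
    simp [hc]

theorem IsPotential.sub {F F' : G → G → X → ℤ} {B B' : G → X → ℚ} (h : IsPotential F B)
    (h' : IsPotential F' B') :
    IsPotential (fun g h x => F g h x - F' g h x) (fun g x => B g x - B' g x) := by
  intro g k
  obtain ⟨c, hc⟩ := h g k
  obtain ⟨c', hc'⟩ := h' g k
  refine ⟨c - c', fun x => ?_⟩
  push_cast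
  linear_combination hc x - hc' x

theorem IsPotential.subgroup {F : G → G → X → ℤ} {B : G → X → ℚ} (h : IsPotential F B)
    (S : Subgroup G) :
    IsPotential (G := S) (fun g h x => F g h x) (fun g x => B g x) :=
  fun g k => h g k

/-- Every lift of a 2-cocycle has a potential, obtained by averaging. -/
theorem exists_isPotential [Finite G] (hπ : IsPermutationQuotient G π) (F : G → G → X → ℤ)
    (hF : groupCohomology.IsCocycle₂ fun q : G × G => π (F q.1 q.2)) :
    ∃ B, IsPotential F B := by
  classical
  have := Fintype.ofFinite G
  have key : ∀ g h j, ∃ c : ℤ, ∀ x,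
      F (g * h) j x + F g h x = F h j (g⁻¹ • x) + F g (h * j) x + c := by
    intro g h j
    have h1 := hF g h j
    simp only [← hπ.map_translate, ← map_add] at h1
    exact (hπ.map_eq_iff _ _).1 h1
  choose c hc using key
  have hN : (Fintype.card G : ℚ) ≠ 0 := by exact_mod_cast Fintype.card_ne_zero
  -- Sum the cocycle identity over its last argument `j` and divide by the group order; the integers
  -- `c g h j` average to a constant.
  refine ⟨fun g x => (∑ j, (F g j x : ℚ)) / Fintype.card G,
    fun g h => ⟨- (∑ j, (c g h j : ℚ)) / Fintype.card G, fun x => ?_⟩⟩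
  have h2 : ∑ j, (F g j x : ℚ) = ∑ j, (F g (h * j) x : ℚ) :=
    (Equiv.sum_comp (Equiv.mulLeft h) (fun j => (F g j x : ℚ))).symm
  have h3 : ∑ j, ((F (g * h) j x : ℚ) + F g h x) =
      ∑ j, ((F h j (g⁻¹ • x) : ℚ) + F g (h * j) x + c g h j) :=
    Finset.sum_congr rfl fun j _ => by exact_mod_cast hc g h j x
  simp only [Finset.sum_add_distrib, Finset.sum_const, Finset.card_univ, nsmul_eq_mul] at h3
  beta_reduce
  rw [h2]
  field_simp
  linarith

/-- A 1-cocycle modulo constants with rational values is a coboundary modulo constants. -/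
theorem exists_eq_coboundary_add_const [Finite G] (D : G → X → ℚ)
    (hD : ∀ g h, ∃ c : ℚ, ∀ x, D g x + D h (g⁻¹ • x) - D (g * h) x = c) :
    ∃ (t : G → ℚ) (b : X → ℚ), ∀ g x, D g x = t g + b x - b (g⁻¹ • x) := by
  classical
  have := Fintype.ofFinite G
  choose c hc using hD
  have hN : (Fintype.card G : ℚ) ≠ 0 := by exact_mod_cast Fintype.card_ne_zero
  -- The same averaging, one degree lower: sum the relation over `h`.
  refine ⟨fun g => (∑ h, c g h) / Fintype.card G, fun x => (∑ h, D h x) / Fintype.card G,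
    fun g x => ?_⟩
  have h2 : ∑ j, D j x = ∑ j, D (g * j) x := (Equiv.sum_comp (Equiv.mulLeft g) (fun j => D j x)).symm
  have h3 : ∑ h, (D g x + D h (g⁻¹ • x) - D (g * h) x) = ∑ h, c g h :=
    Finset.sum_congr rfl fun j _ => hc g j x
  simp only [Finset.sum_add_distrib, Finset.sum_sub_distrib, Finset.sum_const, Finset.card_univ,
    nsmul_eq_mul] at h3
  beta_reduce
  rw [h2]
  field_simp
  linarith

/-- A class with a given potential vanishes if and only if the potential is integral up to
coboundaries. -/
theorem isCoboundary_iff_of_isPotential [Finite G] (hπ : IsPermutationQuotient G π)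
    {F : G → G → X → ℤ} {B : G → X → ℚ} (hB : IsPotential F B) :
    groupCohomology.IsCoboundary₂ (fun q : G × G => π (F q.1 q.2)) ↔
      IsIntegralUpToCoboundary B := by
  constructor
  · rintro ⟨ξ, hξ⟩
    choose Z hZ using fun g => hπ.surjective (ξ g)
    -- Both `B` and the integral lift `Z` of `ξ` have coboundary `F` up to constants, so `B - Z` is
    -- a rational 1-cocycle modulo constants.
    have key : ∀ g h, ∃ c : ℚ, ∀ x,
        (B g x - Z g x) + (B h (g⁻¹ • x) - Z h (g⁻¹ • x)) - (B (g * h) x - Z (g * h) x) = c := by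
      intro g h
      obtain ⟨c, hc⟩ := hB g h
      have h1 := hξ g h
      simp only [← hZ, ← hπ.map_translate, ← map_add, ← map_sub] at h1
      obtain ⟨d, hd⟩ := (hπ.map_eq_iff _ _).1 h1
      refine ⟨c - d, fun x => ?_⟩
      have h2 := hc x
      have h3 : (Z h (g⁻¹ • x) - Z (g * h) x + Z g x : ℚ) = F g h x + d := by
        exact_mod_cast hd x
      linarith
    obtain ⟨t, b, htb⟩ := exists_eq_coboundary_add_const (fun g x => B g x - Z g x) key
    exact ⟨Z, t, b, fun g x => by linear_combination htb g x⟩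
  · rintro ⟨Z, t, b, h⟩
    refine ⟨fun g => π (Z g), fun g k => ?_⟩
    simp only [← hπ.map_translate, ← map_add, ← map_sub]
    rw [← sub_eq_zero, ← map_sub, hπ.map_eq_zero_iff]
    -- In the coboundary of `B` the terms in `b` cancel and those in `t` are independent of the
    -- point, so the coboundary of `Z` differs from `F` by a constant.
    intro x y
    obtain ⟨c, hc⟩ := hB g k
    have hx := hc x
    have hy := hc y
    simp only [h, mul_inv_rev, mul_smul] at hx hy
    have : ((Z k (g⁻¹ • x) - Z (g * k) x + Z g x - F g k x : ℤ) : ℚ) =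
        ((Z k (g⁻¹ • y) - Z (g * k) y + Z g y - F g k y : ℤ) : ℚ) := by
      push_cast
      linarith
    simpa using (Int.cast_injective this)

/-- A 1-cocycle with values in the functions on `X` that vanishes on stabilizers is a
coboundary. -/
theorem exists_coboundary_of_vanish_on_stabilizer {A : Type*} [AddCommGroup A] (a : G → X → A)
    (hcoc : ∀ g h x, a (g * h) x = a g x + a h (g⁻¹ • x))
    (hst : ∀ g x, g • x = x → a g x = 0) :
    ∃ b : X → A, ∀ g x, a g x = b x - b (g⁻¹ • x) := by
  have hout : ∀ x : X, ∃ h : G, h • (Quotient.out (Quotient.mk (MulAction.orbitRel G X) x)) = x := by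
    intro x
    exact MulAction.orbitRel_apply.1 ((MulAction.orbitRel G X).symm
      (Quotient.mk_out (s := MulAction.orbitRel G X) x))
  choose η hη using hout
  -- With `r` a base point of an orbit, `h⁻¹ * h'` stabilizes `r`, where `a` vanishes. Thus the
  -- value of `a` along a path from `r` depends only on the endpoint, and `b` can be defined by it.
  have wd : ∀ (r : X) (h h' : G), h • r = h' • r → a h (h • r) = a h' (h' • r) := by
    intro r h h' e
    have hk : (h⁻¹ * h') • r = r := by rw [mul_smul, ← e, inv_smul_smul]
    have h1 := hcoc h (h⁻¹ * h') (h • r)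
    rw [inv_smul_smul, hst _ _ hk, mul_inv_cancel_left, add_zero] at h1
    rw [← e, h1]
  refine ⟨fun x => a (η x) x, fun g x => ?_⟩
  have hr : Quotient.mk (MulAction.orbitRel G X) (g⁻¹ • x) = Quotient.mk _ x :=
    Quotient.sound (MulAction.orbitRel_apply.2 ⟨g⁻¹, rfl⟩)
  have e1 := hη x
  have e2 := hη (g⁻¹ • x)
  rw [hr] at e2
  set r := Quotient.out (Quotient.mk (MulAction.orbitRel G X) x)
  have e3 : (g⁻¹ * η x) • r = η (g⁻¹ • x) • r := by rw [mul_smul, e1, e2]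
  have h1 := wd r _ _ e3
  rw [e3, e2] at h1
  have h2 := hcoc g (g⁻¹ * η x) x
  rw [mul_inv_cancel_left] at h2
  beta_reduce
  rw [h2, h1, add_sub_cancel_right]

end PermutationQuotient

/-! ### Cocycle criteria for vanishing and for local triviality -/

theorem HTwo.mk_eq_zero_iff {G A : Type*} [Group G] [AddCommGroup A] [DistribMulAction G A]
    (f : twoCocycles G A) : (QuotientAddGroup.mk f : HTwo G A) = 0 ↔
      groupCohomology.IsCoboundary₂ f.1 := by
  rw [QuotientAddGroup.eq_zero_iff, AddSubgroup.mem_addSubgroupOf]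
  rfl

theorem mk_mem_shaTwoCycl_iff {G A : Type*} [Group G] [AddCommGroup A] [DistribMulAction G A]
    (f : twoCocycles G A) : (QuotientAddGroup.mk f : HTwo G A) ∈ ShaTwoCycl G A ↔
      ∀ g : G, groupCohomology.IsCoboundary₂
        (fun q : Subgroup.zpowers g × Subgroup.zpowers g => f.1 ((q.1 : G), (q.2 : G))) := by
  rw [ShaTwoCycl, AddSubgroup.mem_iInf]
  refine forall_congr' fun g => ?_
  rw [AddMonoidHom.mem_ker]
  exact HTwo.mk_eq_zero_iff (resCocycles A (Subgroup.zpowers g) f)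

/-- The cyclic Tate-Shafarevich group of a cyclic group vanishes. -/
theorem shaTwoCycl_eq_bot_of_isCyclic {G A : Type*} [Group G] [AddCommGroup A]
    [DistribMulAction G A] [IsCyclic G] : ShaTwoCycl G A = ⊥ := by
  obtain ⟨g, hg⟩ := IsCyclic.exists_generator (α := G)
  rw [eq_bot_iff]
  intro c hc
  obtain ⟨f, rfl⟩ := QuotientAddGroup.mk_surjective c
  obtain ⟨ξ, hξ⟩ := (mk_mem_shaTwoCycl_iff f).1 hc g
  rw [AddSubgroup.mem_bot, HTwo.mk_eq_zero_iff]
  exact ⟨fun h => ξ ⟨h, hg h⟩, fun h j => hξ ⟨h, hg h⟩ ⟨j, hg j⟩⟩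

/-! ### Rational circle and symmetric cocycles -/

section Circle

/-- The embedding of `ℤ/p` in `ℚ/ℤ` lifted to rational numbers. -/
def zmodToRat (p : ℕ) (z : ZMod p) : ℚ := z.val / p

/-- The carry of the addition of two residues. -/
def zmodCarry (p : ℕ) (z w : ZMod p) : ℤ := ((z.val + w.val) / p : ℕ)

theorem zmodToRat_add (p : ℕ) [NeZero p] (z w : ZMod p) :
    zmodToRat p z + zmodToRat p w - zmodToRat p (z + w) = zmodCarry p z w := by
  have hp : (p : ℚ) ≠ 0 := by exact_mod_cast NeZero.ne p
  have h := Nat.div_add_mod (z.val + w.val) p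
  have h' : (p : ℚ) * ((z.val + w.val) / p : ℕ) + ((z.val + w.val) % p : ℕ) =
      z.val + w.val := by exact_mod_cast h
  simp only [zmodToRat, zmodCarry, ZMod.val_add, Int.cast_natCast]
  field_simp
  linarith

theorem AddCircle.coe_intCast_one (m : ℤ) : ((m : ℚ) : AddCircle (1 : ℚ)) = 0 :=
  (AddCircle.coe_eq_zero_iff 1).2 ⟨m, by simp⟩

theorem AddCircle.exists_intCast_eq {q : ℚ} (h : (q : AddCircle (1 : ℚ)) = 0) :
    ∃ m : ℤ, q = m := by
  obtain ⟨m, hm⟩ := (AddCircle.coe_eq_zero_iff 1).1 h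
  exact ⟨m, by simpa using hm.symm⟩

/-- The embedding of `ℤ/p` in `ℚ/ℤ`. -/
def zmodToCircle (p : ℕ) [NeZero p] : ZMod p →+ AddCircle (1 : ℚ) :=
  AddMonoidHom.mk' (fun z => (zmodToRat p z : AddCircle (1 : ℚ))) (by
    intro z w
    rw [← AddCircle.coe_add, ← sub_eq_zero, ← AddCircle.coe_sub, ← neg_eq_zero,
      ← AddCircle.coe_neg, neg_sub, zmodToRat_add, AddCircle.coe_intCast_one])

theorem zmodToCircle_apply (p : ℕ) [NeZero p] (z : ZMod p) :
    zmodToCircle p z = (zmodToRat p z : AddCircle (1 : ℚ)) := rfl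

theorem zmodToCircle_injective (p : ℕ) [NeZero p] : Function.Injective (zmodToCircle p) := by
  rw [injective_iff_map_eq_zero]
  intro z hz
  obtain ⟨m, hm⟩ := AddCircle.exists_intCast_eq hz
  have hp : (p : ℚ) ≠ 0 := by exact_mod_cast NeZero.ne p
  rw [zmodToRat, div_eq_iff hp] at hm
  have h1 : (z.val : ℤ) = m * p := by exact_mod_cast hm
  have h2 : (p : ℤ) ∣ z.val := ⟨m, by rw [h1, mul_comm]⟩
  have h3 : p ∣ z.val := by exact_mod_cast h2
  exact (ZMod.val_eq_zero z).1 (Nat.eq_zero_of_dvd_of_lt h3 z.val_lt)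

theorem exists_zmodToCircle_eq (p : ℕ) [Fact p.Prime] {q : AddCircle (1 : ℚ)} (hq : p • q = 0) :
    ∃ z, zmodToCircle p z = q := by
  obtain ⟨r, rfl⟩ := QuotientAddGroup.mk_surjective q
  have hp : (p : ℚ) ≠ 0 := by exact_mod_cast NeZero.ne p
  have h1 : ((p * r : ℚ) : AddCircle (1 : ℚ)) = 0 := by
    rw [← nsmul_eq_mul]
    exact hq
  obtain ⟨m, hm⟩ := AddCircle.exists_intCast_eq h1
  have h1p : 1 < p := (Fact.out : p.Prime).one_lt
  refine ⟨(m : ZMod p), ?_⟩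
  have h2 : (m : ZMod p) = m • (1 : ZMod p) := by simp
  rw [h2, map_zsmul, zmodToCircle_apply, ← AddCircle.coe_zsmul]
  change ((m • zmodToRat p 1 : ℚ) : AddCircle (1 : ℚ)) = (r : AddCircle (1 : ℚ))
  congr 1
  have : Fact (1 < p) := ⟨h1p⟩
  rw [zmodToRat, ZMod.val_one, zsmul_eq_mul, ← hm]
  field_simp
  simp

/-- A homomorphism from a group of exponent `p` to `ℚ/ℤ` has values in `ℤ/p`. -/
theorem exists_zmod_hom_lift {G : Type*} [Group G] (p : ℕ) [Fact p.Prime]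
    (hexp : ∀ g : G, g ^ p = 1) (ψ : Additive G →+ AddCircle (1 : ℚ)) :
    ∃ ψ' : Additive G →+ ZMod p, ∀ g, zmodToCircle p (ψ' g) = ψ g := by
  have h : ∀ g, ∃ z, zmodToCircle p z = ψ g := by
    intro g
    refine exists_zmodToCircle_eq p ?_
    rw [← map_nsmul]
    have : p • g = 0 := hexp g.toMul
    rw [this, map_zero]
  choose z hz using h
  refine ⟨AddMonoidHom.mk' z fun g h => zmodToCircle_injective p ?_, hz⟩
  rw [hz, map_add, map_add, hz, hz]

/-- A symmetric 2-cocycle with values in a divisible group is a coboundary. -/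
theorem exists_coboundary_of_symmetric {G A : Type*} [CommGroup G] [AddCommGroup A]
    [DivisibleBy A ℤ] (c : G → G → A) (hsymm : ∀ g h, c g h = c h g)
    (hcoc : ∀ g h j, c g h + c (g * h) j = c h j + c g (h * j)) :
    ∃ t : G → A, ∀ g h, c g h = t g + t h - t (g * h) := by
  have h1 : ∀ h, c 1 h = c 1 1 := by
    intro h
    have := hcoc 1 1 h
    simp only [one_mul] at this
    exact (add_right_cancel (this.trans (add_comm _ _))).symm
  -- The extension of `G` by `A` defined by `c` is abelian because `c` is symmetric. As `A` is
  -- divisible, hence injective, the extension retracts onto `A`, and `t` is the retraction on the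
  -- set-theoretic section. Since `c` is not normalized, the neutral element is `(-c 1 1, 1)` and
  -- `i` is shifted accordingly.
  let Ext := A × G
  let _ : Add Ext := ⟨fun x y => (x.1 + y.1 + c x.2 y.2, x.2 * y.2)⟩
  let _ : Zero Ext := ⟨(-c 1 1, 1)⟩
  let _ : Neg Ext := ⟨fun x => (-x.1 - c x.2 x.2⁻¹ - c 1 1, x.2⁻¹)⟩
  have hadd : ∀ x y : Ext, x + y = (x.1 + y.1 + c x.2 y.2, x.2 * y.2) := fun _ _ => rfl
  have hzero : (0 : Ext) = (-c 1 1, 1) := rfl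
  have hneg : ∀ x : Ext, -x = (-x.1 - c x.2 x.2⁻¹ - c 1 1, x.2⁻¹) := fun _ => rfl
  have hcomm : ∀ x y : Ext, x + y = y + x := by
    intro x y
    rw [hadd, hadd, hsymm, add_comm x.1, mul_comm x.2]
  have hzadd : ∀ x : Ext, 0 + x = x := by
    intro x
    rw [hadd, hzero]
    ext
    · simp [h1]
    · simp
  let _ : AddCommGroup Ext :=
    { add_assoc := by
        intro x y z
        simp only [hadd]
        ext
        · have := hcoc x.2 y.2 z.2
          change x.1 + y.1 + c x.2 y.2 + z.1 + c (x.2 * y.2) z.2 =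
            x.1 + (y.1 + z.1 + c y.2 z.2) + c x.2 (y.2 * z.2)
          rw [show x.1 + y.1 + c x.2 y.2 + z.1 + c (x.2 * y.2) z.2 =
            x.1 + y.1 + z.1 + (c x.2 y.2 + c (x.2 * y.2) z.2) by abel, this]
          abel
        · exact mul_assoc _ _ _
      zero_add := hzadd
      add_zero := fun x => (hcomm _ _).trans (hzadd x)
      add_comm := hcomm
      nsmul := nsmulRec
      zsmul := zsmulRec
      neg_add_cancel := by
        intro x
        rw [hadd, hneg, hzero]
        ext
        · change -x.1 - c x.2 x.2⁻¹ - c 1 1 + x.1 + c x.2⁻¹ x.2 = - c 1 1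
          rw [hsymm x.2⁻¹]
          abel
        · exact inv_mul_cancel _ }
  let i : A →+ Ext := AddMonoidHom.mk' (fun a => (a - c 1 1, 1)) (by
    intro a b
    rw [hadd]
    ext
    · change a + b - c 1 1 = a - c 1 1 + (b - c 1 1) + c 1 1
      abel
    · exact (one_mul _).symm)
  have hi : Function.Injective i := by
    intro a b hab
    have : a - c 1 1 = b - c 1 1 := congrArg Prod.fst hab
    simpa using this
  obtain ⟨r, hr⟩ := (Module.Baer.of_divisible A).extension_property_addMonoidHom i hi
    (AddMonoidHom.id A)
  refine ⟨fun g => r ((0, g) : A × G), fun g h => ?_⟩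
  have e : ((0, g) : Ext) + ((0, h) : Ext) = i (c g h) + ((0, g * h) : Ext) := by
    rw [hadd, hadd]
    ext
    · change 0 + 0 + c g h = c g h - c 1 1 + 0 + c 1 (g * h)
      rw [h1 (g * h)]
      abel
    · exact (one_mul _).symm
  have e2 := congrArg r e
  rw [map_add, map_add] at e2
  have e3 : r (i (c g h)) = c g h := DFunLike.congr_fun hr _
  rw [e3] at e2
  rw [e2, add_sub_cancel_right]

end Circle

/-! ### Classes attached to families of homomorphisms to ℤ/p -/

section PermutationQuotient

/-- Reducing modulo `ℤ` absorbs the integral cochain `Z`; all later computations take place in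
`ℚ/ℤ`. -/
theorem isIntegralUpToCoboundary_iff {G X : Type*} [Group G] [MulAction G X] (B : G → X → ℚ) :
    IsIntegralUpToCoboundary B ↔ ∃ (t : G → AddCircle (1 : ℚ)) (b : X → AddCircle (1 : ℚ)),
      ∀ g x, (B g x : AddCircle (1 : ℚ)) = t g + b x - b (g⁻¹ • x) := by
  constructor
  · rintro ⟨Z, t, b, h⟩
    refine ⟨fun g => t g, fun x => b x, fun g x => ?_⟩
    rw [h, AddCircle.coe_sub, AddCircle.coe_add, AddCircle.coe_add, AddCircle.coe_intCast_one,
      zero_add]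
  · rintro ⟨t, b, h⟩
    choose t' ht' using fun g => QuotientAddGroup.mk_surjective (t g)
    choose b' hb' using fun x => QuotientAddGroup.mk_surjective (b x)
    have key : ∀ g x, ∃ m : ℤ, B g x - (t' g + b' x - b' (g⁻¹ • x)) = m := by
      intro g x
      apply AddCircle.exists_intCast_eq
      rw [AddCircle.coe_sub, AddCircle.coe_sub, AddCircle.coe_add, h, sub_eq_zero,
        ← ht', ← hb', ← hb']
    choose Z hZ using key
    exact ⟨Z, t', b', fun g x => by linear_combination hZ g x⟩

variable {G : Type*} [CommGroup G] {X : Type*} [MulAction G X] {M : Type*}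
  [AddCommGroup M] [DistribMulAction G M] {π : (X → ℤ) →+ M}
  {I : Type*} {s : X → I} {H : I → Subgroup G} {p : ℕ} [Fact p.Prime]

/-- The 2-cochain of `ℤ^X` given by a family of homomorphisms `φ i : G → ℤ/p`, through the
connecting homomorphism for `0 → ℤ → ℤ → ℤ/p → 0`. -/
def carryCochain (s : X → I) (φ : I → Additive G →+ ZMod p) (g h : G) (x : X) : ℤ :=
  zmodCarry p (φ (s x) (Additive.ofMul g)) (φ (s x) (Additive.ofMul h))

theorem isPotential_carryCochain (hs : ∀ (g : G) x, s (g • x) = s x)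
    (φ : I → Additive G →+ ZMod p) :
    IsPotential (carryCochain s φ) (fun g x => zmodToRat p (φ (s x) (Additive.ofMul g))) := by
  intro g h
  refine ⟨0, fun x => ?_⟩
  simp only [hs, ofMul_mul, map_add]
  rw [zmodToRat_add, add_zero]
  rfl

/-- The cocycle with values in `M` given by a family of homomorphisms `φ i : G → ℤ/p`. -/
def carryCocycle (hπ : IsPermutationQuotient G π) (hs : ∀ (g : G) x, s (g • x) = s x)
    (φ : I → Additive G →+ ZMod p) : twoCocycles G M :=
  ⟨fun q => π (carryCochain s φ q.1 q.2), by
    intro g h j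
    simp only [← hπ.map_translate, ← map_add]
    congr 1
    funext x
    -- Over `ℚ` the carry is a coboundary, from which the cocycle identity is formal.
    have e : ∀ g h x, (carryCochain s φ g h x : ℚ) = zmodToRat p (φ (s x) (Additive.ofMul g)) +
        zmodToRat p (φ (s x) (Additive.ofMul h)) -
        zmodToRat p (φ (s x) (Additive.ofMul (g * h))) := by
      intro g h x
      rw [ofMul_mul, map_add, zmodToRat_add]
      rfl
    have : ((carryCochain s φ (g * h) j x + carryCochain s φ g h x : ℤ) : ℚ) =
        (carryCochain s φ h j (g⁻¹ • x) + carryCochain s φ g (h * j) x : ℤ) := by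
      push_cast
      simp only [e, hs, mul_assoc]
      ring
    exact_mod_cast this⟩

variable [Finite G]

theorem mk_eq_mk_iff_of_isPotential (hπ : IsPermutationQuotient G π) {f f' : twoCocycles G M}
    {F F' : G → G → X → ℤ} {B B' : G → X → ℚ} (hf : ∀ g h, f.1 (g, h) = π (F g h))
    (hf' : ∀ g h, f'.1 (g, h) = π (F' g h)) (hB : IsPotential F B) (hB' : IsPotential F' B') :
    (QuotientAddGroup.mk f : HTwo G M) = QuotientAddGroup.mk f' ↔
      IsIntegralUpToCoboundary (fun g x => B g x - B' g x) := by
  rw [← isCoboundary_iff_of_isPotential hπ (hB.sub hB'), ← sub_eq_zero]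
  refine (HTwo.mk_eq_zero_iff (f - f')).trans ?_
  have : (f - f').1 = fun q : G × G => π (fun x => F q.1 q.2 x - F' q.1 q.2 x) := by
    ext ⟨g, h⟩
    change f.1 (g, h) - f'.1 (g, h) = π (F g h - F' g h)
    rw [hf, hf', map_sub]
  rw [this]

/-- The classes of the cocycles `carryCocycle`. -/
def carryClass (hπ : IsPermutationQuotient G π) (hs : ∀ (g : G) x, s (g • x) = s x) :
    (I → Additive G →+ ZMod p) →+ HTwo G M :=
  AddMonoidHom.mk' (fun φ => QuotientAddGroup.mk (carryCocycle hπ hs φ)) (by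
    intro φ φ'
    -- The potential of `φ + φ'` and the sum of the two potentials agree in `ℚ/ℤ`, although they may
    -- differ as rational numbers.
    rw [← QuotientAddGroup.mk_add, mk_eq_mk_iff_of_isPotential hπ
      (f' := carryCocycle hπ hs φ + carryCocycle hπ hs φ')
      (F' := fun g h => carryCochain s φ g h + carryCochain s φ' g h)
      (B' := fun g x => zmodToRat p (φ (s x) (Additive.ofMul g)) +
        zmodToRat p (φ' (s x) (Additive.ofMul g)))
      (fun _ _ => rfl) (fun _ _ => (map_add π _ _).symm) (isPotential_carryCochain hs _)]
    · rw [isIntegralUpToCoboundary_iff]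
      refine ⟨0, 0, fun g x => ?_⟩
      rw [AddCircle.coe_sub, AddCircle.coe_add]
      simp only [← zmodToCircle_apply]
      simp
    · intro g h
      refine ⟨0, fun x => ?_⟩
      simp only [hs, ofMul_mul, map_add, Pi.add_apply, Int.cast_add, carryCochain,
        ← zmodToRat_add]
      ring)

theorem carryClass_apply (hπ : IsPermutationQuotient G π) (hs : ∀ (g : G) x, s (g • x) = s x)
    (φ : I → Additive G →+ ZMod p) :
    carryClass hπ hs φ = QuotientAddGroup.mk (carryCocycle hπ hs φ) := rfl

/-- The cocycle of `φ` is trivial on a subgroup `S` on which a single homomorphism induces all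
`φ i` on the stabilizers. -/
theorem isCoboundary_carryCocycle_of_eq (hπ : IsPermutationQuotient G π)
    (hs : ∀ (g : G) x, s (g • x) = s x) (hst : ∀ (g : G) x, g • x = x → g ∈ H (s x))
    (φ : I → Additive G →+ ZMod p) (S : Subgroup G) (ψ : Additive G →+ ZMod p)
    (hψ : ∀ i, ∀ g ∈ S, g ∈ H i → φ i (Additive.ofMul g) = ψ (Additive.ofMul g)) :
    groupCohomology.IsCoboundary₂
      (fun q : S × S => (carryCocycle hπ hs φ).1 ((q.1 : G), (q.2 : G))) := by
  refine (isCoboundary_iff_of_isPotential (hπ.subgroup S)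
    ((isPotential_carryCochain hs φ).subgroup S)).2 ?_
  rw [isIntegralUpToCoboundary_iff]
  -- On `S` the difference `φ (s x) - ψ` is a cocycle that vanishes on stabilizers, so it is a
  -- coboundary; `ψ` itself does not depend on `x`.
  obtain ⟨b, hb⟩ := exists_coboundary_of_vanish_on_stabilizer (G := S) (X := X)
    (fun g x => φ (s x) (Additive.ofMul (g : G)) - ψ (Additive.ofMul (g : G)))
    (by
      intro g h x
      have : s (g⁻¹ • x) = s x := hs _ x
      simp only [this, Subgroup.coe_mul, ofMul_mul, map_add]
      abel)
    (by
      intro g x hgx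
      rw [hψ _ _ g.2 (hst _ _ hgx), sub_self])
  refine ⟨fun g => zmodToCircle p (ψ (Additive.ofMul (g : G))), fun x => zmodToCircle p (b x),
    fun g x => ?_⟩
  rw [← zmodToCircle_apply, add_sub_assoc, ← map_sub, ← hb, ← map_add, add_sub_cancel]

/-- On a cyclic subgroup one homomorphism suffices: `φ i` if the generator lies in some `H i`.
Otherwise the zero map works, since in exponent `p` a cyclic subgroup not contained in `H j` meets
it trivially. -/
theorem carryClass_mem_shaTwoCycl (hexp : ∀ g : G, g ^ p = 1) (hπ : IsPermutationQuotient G π)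
    (hs : ∀ (g : G) x, s (g • x) = s x) (hst : ∀ (g : G) x, g • x = x → g ∈ H (s x))
    (φ : I → Additive G →+ ZMod p)
    (hφ : ∀ i j, ∀ g ∈ H i, g ∈ H j → φ i (Additive.ofMul g) = φ j (Additive.ofMul g)) :
    carryClass hπ hs φ ∈ ShaTwoCycl G M := by
  rw [carryClass_apply, mk_mem_shaTwoCycl_iff]
  intro g
  by_cases hg : ∃ i, g ∈ H i
  · obtain ⟨i, hi⟩ := hg
    refine isCoboundary_carryCocycle_of_eq hπ hs hst φ _ (φ i) fun j h hh hj => ?_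
    have : h ∈ H i := (Subgroup.zpowers_le.2 hi) hh
    exact hφ j i h hj this
  · refine isCoboundary_carryCocycle_of_eq hπ hs hst φ _ 0 fun j h hh hj => ?_
    obtain ⟨k, rfl⟩ := Subgroup.mem_zpowers_iff.1 hh
    -- If `k` were prime to `p`, then `g` would be a power of `g ^ k`, hence in `H j`.
    have hk : ¬ IsCoprime k p := by
      rintro ⟨a, b, hab⟩
      refine hg ⟨j, ?_⟩
      have h1 : g = (g ^ k) ^ a := by
        rw [← zpow_mul]
        nth_rw 1 [← zpow_one g, ← hab]
        rw [zpow_add, mul_comm b, zpow_mul g p, zpow_natCast, hexp, one_zpow, mul_one, mul_comm]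
      rw [h1]
      exact zpow_mem hj a
    rw [isCoprime_comm, (Nat.prime_iff_prime_int.1 (Fact.out : p.Prime)).coprime_iff_not_dvd,
      not_not] at hk
    obtain ⟨m, rfl⟩ := hk
    rw [zpow_mul, zpow_natCast, hexp, one_zpow, ofMul_one, map_zero, map_zero]

/-- The relations between the classes `carryClass`. -/
theorem carryClass_eq_zero_iff (hπ : IsPermutationQuotient G π)
    (hexp : ∀ g : G, g ^ p = 1) (hs : ∀ (g : G) x, s (g • x) = s x)
    (hst : ∀ (g : G) x, g • x = x ↔ g ∈ H (s x)) (hsurj : Function.Surjective s) [Nonempty I]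
    (φ : I → Additive G →+ ZMod p) :
    carryClass hπ hs φ = 0 ↔ ∃ ψ : Additive G →+ ZMod p, ∀ i, ∀ g ∈ H i,
      φ i (Additive.ofMul g) = ψ (Additive.ofMul g) := by
  constructor
  · intro h
    rw [carryClass_apply, HTwo.mk_eq_zero_iff] at h
    obtain ⟨t, b, htb⟩ := (isIntegralUpToCoboundary_iff _).1
      ((isCoboundary_iff_of_isPotential hπ (isPotential_carryCochain hs φ)).1 h)
    simp only [← zmodToCircle_apply] at htb
    obtain ⟨i₀⟩ := ‹Nonempty I›
    obtain ⟨x₀, -⟩ := hsurj i₀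
    -- Along `x₀` both `φ (s x₀)` and the coboundary of `b` are additive, so `t` is too. On the
    -- stabilizer of a point the terms in `b` cancel and `t` equals `φ i`.
    have ht : ∀ g h, t (g * h) = t g + t h := by
      intro g h
      have e1 := htb g x₀
      have e2 := htb h (g⁻¹ • x₀)
      have e3 := htb (g * h) x₀
      rw [hs, smul_smul, ← mul_inv_rev] at e2
      rw [ofMul_mul, map_add, map_add, e1, e2] at e3
      have e4 : t g + t h + (b x₀ - b ((g * h)⁻¹ • x₀)) =
          t (g * h) + (b x₀ - b ((g * h)⁻¹ • x₀)) := by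
        rw [← add_sub_assoc, ← add_sub_assoc, ← e3]
        abel
      exact (add_right_cancel e4).symm
    obtain ⟨ψ, hψ⟩ := exists_zmod_hom_lift p hexp
      (AddMonoidHom.mk' (fun g : Additive G => t g.toMul) fun g h => ht _ _)
    refine ⟨ψ, fun i g hg => zmodToCircle_injective p ?_⟩
    obtain ⟨x, rfl⟩ := hsurj i
    have hx : g⁻¹ • x = x := inv_smul_eq_iff.2 ((hst g x).2 hg).symm
    rw [hψ, htb, hx, add_sub_cancel_right]
    rfl
  · rintro ⟨ψ, hψ⟩
    rw [carryClass_apply, HTwo.mk_eq_zero_iff]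
    obtain ⟨ξ, hξ⟩ := isCoboundary_carryCocycle_of_eq hπ hs (fun g x => (hst g x).1) φ ⊤ ψ
      fun i g _ hg => hψ i g hg
    exact ⟨fun g => ξ ⟨g, trivial⟩, fun g h => hξ ⟨g, trivial⟩ ⟨h, trivial⟩⟩

/-- Every class of the cyclic Tate-Shafarevich group is given by a compatible family of
homomorphisms. -/
theorem exists_carryClass_eq_of_mem_shaTwoCycl (hπ : IsPermutationQuotient G π)
    (hexp : ∀ g : G, g ^ p = 1) (hs : ∀ (g : G) x, s (g • x) = s x)
    (hst : ∀ (g : G) x, g • x = x ↔ g ∈ H (s x)) (hsurj : Function.Surjective s)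
    {i₁ i₂ : I} (hgen : H i₁ ⊔ H i₂ = ⊤) (γ : HTwo G M) (hγ : γ ∈ ShaTwoCycl G M) :
    ∃ φ : I → Additive G →+ ZMod p,
      (∀ i j, ∀ g ∈ H i, g ∈ H j → φ i (Additive.ofMul g) = φ j (Additive.ofMul g)) ∧
      carryClass hπ hs φ = γ := by
  obtain ⟨f, rfl⟩ := QuotientAddGroup.mk_surjective γ
  choose F hF using fun q => hπ.surjective (f.1 q)
  obtain ⟨B, hB⟩ := exists_isPotential hπ (fun g h => F (g, h)) (by simpa only [hF] using! f.2)
  choose x hx using hsurj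
  -- Triviality on `⟨g⟩` writes `B` modulo `ℤ` as `t` plus a coboundary, and the coboundary
  -- disappears at fixed points of `g`.
  have hfix : ∀ g y z, g • y = y → g • z = z →
      (B g y : AddCircle (1 : ℚ)) = (B g z : AddCircle (1 : ℚ)) := by
    intro g y z hy hz
    have h1 := (mk_mem_shaTwoCycl_iff f).1 hγ g
    have h2 := (isCoboundary_iff_of_isPotential (hπ.subgroup (Subgroup.zpowers g))
      (hB.subgroup (Subgroup.zpowers g))).1 (by simpa only [hF] using h1)
    obtain ⟨t, b, htb⟩ := (isIntegralUpToCoboundary_iff _).1 h2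
    have e : ∀ y, g • y = y → (B g y : AddCircle (1 : ℚ)) = t ⟨g, Subgroup.mem_zpowers g⟩ := by
      intro y hy
      have h3 := htb ⟨g, Subgroup.mem_zpowers g⟩ y
      have h4 : (⟨g, Subgroup.mem_zpowers g⟩ : Subgroup.zpowers g)⁻¹ • y = y :=
        inv_smul_eq_iff.2 hy.symm
      rw [h4, add_sub_cancel_right] at h3
      exact h3
    rw [e y hy, e z hz]
  choose c' hc' using hB
  obtain ⟨a, ha⟩ : ∃ a : G → X → AddCircle (1 : ℚ), ∀ g y, a g y = B g y := ⟨_, fun _ _ => rfl⟩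
  -- The cocycle `c` represents the obstruction in `H²(G, ℚ/ℤ)`; it can be computed at any point
  -- `y`.
  obtain ⟨c, hc⟩ : ∃ c : G → G → AddCircle (1 : ℚ), ∀ g h y,
      c g h = a g y + a h (g⁻¹ • y) - a (g * h) y := by
    refine ⟨fun g h => c' g h, fun g h y => ?_⟩
    rw [ha, ha, ha, ← AddCircle.coe_add, ← AddCircle.coe_sub, hc', AddCircle.coe_add,
      AddCircle.coe_intCast_one, zero_add]
  simp only [← ha] at hfix
  -- Compute both sides at `x i`: as `g` fixes `x i` and `h⁻¹ • x i`, `hfix` equates the two values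
  -- of `a g`.
  have hsymm₁ : ∀ i, ∀ g ∈ H i, ∀ h, c g h = c h g := by
    intro i g hg h
    have hgx : ∀ y, s y = i → g • y = y := fun y hy => (hst g y).2 (hy ▸ hg)
    rw [hc g h (x i), hc h g (x i), inv_smul_eq_iff.2 (hgx _ (hx i)).symm,
      hfix g (h⁻¹ • x i) (x i) (hgx _ ((hs _ _).trans (hx i))) (hgx _ (hx i)), mul_comm g h,
      add_comm (a g _)]
  have hcoc : ∀ g h j, c g h + c (g * h) j = c h j + c g (h * j) := by
    intro g h j
    rw [hc g h (x i₁), hc (g * h) j (x i₁), hc h j (g⁻¹ • x i₁), hc g (h * j) (x i₁), mul_inv_rev,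
      mul_smul, mul_assoc]
    abel
  -- Write `g = g₁ * g₂` with factors in `H i₁` and `H i₂`, and combine three cocycle identities
  -- with the symmetry known for each factor.
  have hsymm : ∀ g h, c g h = c h g := by
    intro g h
    obtain ⟨g₁, hg₁, g₂, hg₂, rfl⟩ := Subgroup.mem_sup.1 (hgen ▸ Subgroup.mem_top g)
    have e1 := hcoc g₁ g₂ h
    have e2 := hcoc h g₁ g₂
    have e3 := hcoc g₂ h g₁
    rw [hsymm₁ i₁ g₁ hg₁ g₂] at e1 e2
    rw [hsymm₁ i₁ g₁ hg₁ (g₂ * h)] at e1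
    rw [← hsymm₁ i₂ g₂ hg₂ (h * g₁), ← e3, ← e1] at e2
    exact add_left_cancel e2
  obtain ⟨t, ht⟩ := exists_coboundary_of_symmetric c hsymm hcoc
  -- Subtracting `t` removes the constants and leaves a genuine 1-cocycle with values in the
  -- functions `X → ℚ/ℤ`.
  obtain ⟨a', ha'⟩ : ∃ a' : G → X → AddCircle (1 : ℚ), ∀ g y, a' g y = a g y - t g :=
    ⟨_, fun _ _ => rfl⟩
  have ha'coc : ∀ g h y, a' (g * h) y = a' g y + a' h (g⁻¹ • y) := by
    intro g h y
    have := (hc g h y).symm.trans (ht g h)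
    rw [ha', ha', ha', ← sub_eq_zero]
    rw [← sub_eq_zero] at this
    rw [← neg_eq_zero, ← this]
    abel
  have hfix' : ∀ g y z, g • y = y → g • z = z → a' g y = a' g z := by
    intro g y z hy hz
    rw [ha', ha', hfix g y z hy hz]
  have hstx : ∀ i, ∀ g ∈ H i, g • x i = x i := fun i g hg => (hst g (x i)).2 ((hx i).symm ▸ hg)
  -- At `x i` the cocycle restricts to a homomorphism on `H i`. It extends to `G` because `ℚ/ℤ` is
  -- injective, and takes values in `ℤ/p` because `G` has exponent `p`.
  have key : ∀ i, ∃ φ : Additive G →+ ZMod p, ∀ g ∈ H i,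
      zmodToCircle p (φ (Additive.ofMul g)) = a' g (x i) := by
    intro i
    obtain ⟨Φ, hΦ⟩ := (Module.Baer.of_divisible (AddCircle (1 : ℚ))).extension_property_addMonoidHom
      (MonoidHom.toAdditive (H i).subtype) Subtype.val_injective
      (AddMonoidHom.mk' (fun g : Additive (H i) => a' (g.toMul : G) (x i)) (by
        intro g h
        have := ha'coc (g.toMul : G) (h.toMul : G) (x i)
        rw [inv_smul_eq_iff.2 (hstx i _ g.toMul.2).symm] at this
        exact this))
    obtain ⟨φ, hφ⟩ := exists_zmod_hom_lift p hexp Φ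
    exact ⟨φ, fun g hg => (hφ _).trans (DFunLike.congr_fun hΦ (Additive.ofMul ⟨g, hg⟩))⟩
  choose φ hφ using key
  refine ⟨φ, fun i j g hi hj => zmodToCircle_injective p ?_, ?_⟩
  · rw [hφ i g hi, hφ j g hj]
    exact hfix' _ _ _ (hstx i g hi) (hstx j g hj)
  · obtain ⟨b, hb⟩ := exists_coboundary_of_vanish_on_stabilizer
      (fun g y => a' g y - zmodToCircle p (φ (s y) (Additive.ofMul g)))
      (by
        intro g h y
        rw [ha'coc, hs, ofMul_mul, map_add, map_add]
        abel)
      (by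
        intro g y hy
        have hg := (hst g y).1 hy
        rw [hφ _ g hg, hfix' g y _ hy (hstx _ g hg), sub_self])
    symm
    rw [carryClass_apply, mk_eq_mk_iff_of_isPotential hπ (fun g h => (hF (g, h)).symm)
      (fun g h => rfl) (fun g h => ⟨c' g h, hc' g h⟩) (isPotential_carryCochain hs φ),
      isIntegralUpToCoboundary_iff]
    refine ⟨t, b, fun g y => ?_⟩
    rw [AddCircle.coe_sub, ← ha, ← zmodToCircle_apply, add_sub_assoc, ← hb, ha']
    abel

end PermutationQuotient

/-! ### Families of subgroups of prime index -/

section PrimeIndex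

variable {G : Type*} [CommGroup G] {p : ℕ}

theorem Subgroup.sup_eq_top_of_index_prime (hp : p.Prime) {H K : Subgroup G} (hH : H.index = p)
    (hK : ¬ K ≤ H) : H ⊔ K = ⊤ := by
  have h1 := Subgroup.relIndex_mul_index (le_sup_left : H ≤ H ⊔ K)
  rw [hH] at h1
  rcases (Nat.dvd_prime hp).1 (Dvd.intro_left _ h1) with h | h
  · exact Subgroup.index_eq_one.1 h
  · rw [h] at h1
    have h2 : H.relIndex (H ⊔ K) = 1 := Nat.eq_of_mul_eq_mul_right hp.pos (by rw [h1, one_mul])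
    exact absurd (le_sup_right.trans (Subgroup.relIndex_eq_one.1 h2)) hK

theorem Subgroup.not_le_of_index_eq [Finite G] {H K : Subgroup G} (hHK : H.index = K.index)
    (hne : H ≠ K) : ¬ K ≤ H := by
  intro h
  refine hne (Subgroup.eq_of_le_of_card_ge h ?_).symm
  have h1 := H.card_mul_index
  rw [← K.card_mul_index, hHK] at h1
  exact (Nat.eq_of_mul_eq_mul_right (Nat.pos_of_ne_zero Subgroup.index_ne_zero_of_finite) h1).le

theorem Subgroup.exists_mul_zpow_mem_of_index_prime (hp : p.Prime) {H : Subgroup G}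
    (hH : H.index = p) {u : G} (hu : u ∉ H) (g : G) : ∃ k : ℤ, g * u ^ k ∈ H := by
  have h := Subgroup.sup_eq_top_of_index_prime hp hH (K := Subgroup.zpowers u)
    fun h => hu (h (Subgroup.mem_zpowers u))
  obtain ⟨a, ha, b, hb, hab⟩ := Subgroup.mem_sup.1 (h ▸ Subgroup.mem_top g)
  obtain ⟨k, rfl⟩ := Subgroup.mem_zpowers_iff.1 hb
  refine ⟨-k, ?_⟩
  rwa [← hab, zpow_neg, mul_inv_cancel_right]

/-- Homomorphisms that agree on the intersection of two subgroups generating the group can be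
glued. -/
theorem exists_glue_of_sup_eq_top {A : Type*} [AddCommGroup A] {H₀ H₁ : Subgroup G}
    (hgen : H₀ ⊔ H₁ = ⊤) (φ₀ φ₁ : Additive G →+ A)
    (h : ∀ g ∈ H₀, g ∈ H₁ → φ₀ (Additive.ofMul g) = φ₁ (Additive.ofMul g)) :
    ∃ ψ : Additive G →+ A, (∀ g ∈ H₀, φ₀ (Additive.ofMul g) = ψ (Additive.ofMul g)) ∧
      ∀ g ∈ H₁, φ₁ (Additive.ofMul g) = ψ (Additive.ofMul g) := by
  have hdec : ∀ g : G, ∃ a ∈ H₀, ∃ b ∈ H₁, a * b = g := fun g =>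
    Subgroup.mem_sup.1 (hgen ▸ Subgroup.mem_top g)
  choose a ha b hb hab using hdec
  have wd : ∀ x ∈ H₀, ∀ y ∈ H₁, φ₀ (Additive.ofMul (a (x * y))) +
      φ₁ (Additive.ofMul (b (x * y))) = φ₀ (Additive.ofMul x) + φ₁ (Additive.ofMul y) := by
    intro x hx y hy
    have e : (a (x * y))⁻¹ * x = b (x * y) * y⁻¹ := by
      rw [inv_mul_eq_iff_eq_mul, ← mul_assoc, hab, mul_inv_cancel_right]
    have h1 := h ((a (x * y))⁻¹ * x) (mul_mem (inv_mem (ha _)) hx)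
      (e ▸ mul_mem (hb _) (inv_mem hy))
    rw [e] at h1
    nth_rw 1 [← e] at h1
    simp only [ofMul_mul, ofMul_inv, map_add, map_neg] at h1
    rw [neg_add_eq_sub, ← sub_eq_add_neg, sub_eq_sub_iff_add_eq_add] at h1
    rw [h1, add_comm]
  refine ⟨AddMonoidHom.mk' (fun g => φ₀ (Additive.ofMul (a g.toMul)) +
    φ₁ (Additive.ofMul (b g.toMul))) ?_, ?_, ?_⟩
  · intro g k
    have e : (g + k).toMul = (a g.toMul * a k.toMul) * (b g.toMul * b k.toMul) := by
      rw [mul_mul_mul_comm, hab, hab]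
      rfl
    rw [e, wd _ (mul_mem (ha _) (ha _)) _ (mul_mem (hb _) (hb _)), ofMul_mul, ofMul_mul, map_add,
      map_add]
    abel
  · intro g hg
    have := wd g hg 1 (one_mem _)
    rw [mul_one, ofMul_one, map_zero, add_zero] at this
    exact this.symm
  · intro g hg
    have := wd 1 (one_mem _) g hg
    rw [one_mul, ofMul_one, map_zero, zero_add] at this
    exact this.symm

/-- A compatible family of homomorphisms on subgroups of prime index with trivial intersection
comes from a homomorphism on the group, if two of the subgroups intersect nontrivially. -/
theorem exists_hom_of_compatible [Finite G] (hp : p.Prime) {A : Type*} [AddCommGroup A] {I : Type*}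
    {H : I → Subgroup G} (hindex : ∀ i, (H i).index = p) (hinj : Function.Injective H)
    (hinf : ⨅ i, H i = ⊥) {i₀ i₁ : I} (hi : i₀ ≠ i₁) (hU : H i₀ ⊓ H i₁ ≠ ⊥)
    (φ : I → Additive G →+ A)
    (hφ : ∀ i j, ∀ g ∈ H i, g ∈ H j → φ i (Additive.ofMul g) = φ j (Additive.ofMul g)) :
    ∃ ψ : Additive G →+ A, ∀ i, ∀ g ∈ H i, φ i (Additive.ofMul g) = ψ (Additive.ofMul g) := by
  have hgen : H i₀ ⊔ H i₁ = ⊤ := Subgroup.sup_eq_top_of_index_prime hp (hindex i₀)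
    (Subgroup.not_le_of_index_eq ((hindex _).trans (hindex _).symm) (hinj.ne hi))
  obtain ⟨ψ, hψ₀, hψ₁⟩ := exists_glue_of_sup_eq_top hgen (φ i₀) (φ i₁) (hφ i₀ i₁)
  -- Split `g = a * b` along `H i₀` and `H i₁`. A power of `u` moves `a` into `H j` without leaving
  -- `H i₀`, and the inverse power keeps `b` in `H i₁`; both factors then lie in `H j`, where
  -- compatibility applies.
  have step : ∀ j u, u ∈ H i₀ → u ∈ H i₁ → u ∉ H j → ∀ g ∈ H j,
      φ j (Additive.ofMul g) = ψ (Additive.ofMul g) := by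
    intro j u hu₀ hu₁ huj g hg
    obtain ⟨a, ha, b, hb, rfl⟩ := Subgroup.mem_sup.1 (hgen ▸ Subgroup.mem_top g)
    obtain ⟨k, hk⟩ := Subgroup.exists_mul_zpow_mem_of_index_prime hp (hindex j) huj a
    have e : a * b = (a * u ^ k) * ((u ^ k)⁻¹ * b) := by group
    have h1 : a * u ^ k ∈ H i₀ := mul_mem ha (zpow_mem hu₀ k)
    have h2 : (u ^ k)⁻¹ * b ∈ H i₁ := mul_mem (inv_mem (zpow_mem hu₁ k)) hb
    have h3 : (u ^ k)⁻¹ * b ∈ H j := by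
      rw [e] at hg
      exact (Subgroup.mul_mem_cancel_left _ hk).1 hg
    rw [e, ofMul_mul, map_add, map_add, hφ j i₀ _ hk h1, hφ j i₁ _ h3 h2, hψ₀ _ h1, hψ₁ _ h2]
  refine ⟨ψ, fun j g hg => ?_⟩
  obtain ⟨w, hw1⟩ := Subgroup.ne_bot_iff_exists_ne_one.1 hU
  have hw := w.2
  have hw1' : (w : G) ≠ 1 := fun h => hw1 (Subtype.ext h)
  obtain ⟨hw₀, hw₁⟩ := Subgroup.mem_inf.1 hw
  by_cases hwj : (w : G) ∈ H j
  -- If `w ∈ H j`, some `H l` misses `w`. A power of `w` moves `g` into `H l`, where `step` applies,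
  -- and the values at `w` already agree.
  · obtain ⟨l, hl⟩ : ∃ l, (w : G) ∉ H l := by
      by_contra! h
      exact hw1' (Subgroup.mem_bot.1 (hinf ▸ Subgroup.mem_iInf.2 h))
    obtain ⟨k, hk⟩ := Subgroup.exists_mul_zpow_mem_of_index_prime hp (hindex l) hl g
    have h1 := hφ j l _ (mul_mem hg (zpow_mem hwj k)) hk
    rw [step l w hw₀ hw₁ hl _ hk] at h1
    have h2 : φ j (Additive.ofMul (w : G)) = ψ (Additive.ofMul (w : G)) := by
      rw [hφ j i₀ _ hwj hw₀, hψ₀ _ hw₀]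
    simpa only [ofMul_mul, ofMul_zpow, map_add, map_zsmul, h2, add_left_inj] using h1
  · exact step j w hw₀ hw₁ hwj g hg

end PrimeIndex

/-! ### Linear algebra over ℤ/p -/

section ElementaryAbelian

variable {G : Type*} [CommGroup G] {p : ℕ} [Fact p.Prime]

theorem card_of_mulEquiv_zmod_prod
    (e : G ≃* Multiplicative (ZMod p) × Multiplicative (ZMod p)) : Nat.card G = p * p := by
  rw [Nat.card_congr e.toEquiv, Nat.card_prod]
  change Nat.card (ZMod p) * Nat.card (ZMod p) = _
  rw [Nat.card_zmod]

/-- The two-dimensional case: the module structure over `ℤ/p`. -/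
theorem finrank_additive_eq_two [Module (ZMod p) (Additive G)]
    [Finite G] (hcard : Nat.card G = p * p) :
    Module.finrank (ZMod p) (Additive G) = 2 := by
  have : Module.Finite (ZMod p) (Additive G) := Module.Finite.of_finite
  have h1 := Module.natCard_eq_pow_finrank (K := ZMod p) (V := Additive G)
  rw [Nat.card_zmod] at h1
  have h2 : Nat.card (Additive G) = p ^ 2 := by rw [sq]; exact hcard
  rw [h2] at h1
  exact (Nat.pow_right_injective (Fact.out : p.Prime).two_le h1).symm

theorem nonempty_addEquiv_prod_of_finrank {W : Type*} [AddCommGroup W] [Module (ZMod p) W]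
    (h : Module.finrank (ZMod p) W = 2) : Nonempty (W ≃+ ZMod p × ZMod p) := by
  have : FiniteDimensional (ZMod p) W := Module.finite_of_finrank_pos (by omega)
  have e : W ≃ₗ[ZMod p] ZMod p × ZMod p :=
    LinearEquiv.ofFinrankEq _ _ (by rw [h, Module.finrank_prod, Module.finrank_self])
  exact ⟨e.toAddEquiv⟩

theorem nonempty_mulEquiv_zmod_prod [Finite G] (hexp : ∀ g : G, g ^ p = 1)
    (hcard : Nat.card G = p * p) :
    Nonempty (G ≃* Multiplicative (ZMod p) × Multiplicative (ZMod p)) := by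
  let _ : Module (ZMod p) (Additive G) := AddCommGroup.zmodModule fun g => hexp g.toMul
  obtain ⟨e⟩ := nonempty_addEquiv_prod_of_finrank (finrank_additive_eq_two (p := p) hcard)
  exact ⟨(AddEquiv.toMultiplicativeRight e).trans (MulEquiv.prodMultiplicative _ _)⟩

end ElementaryAbelian

theorem nonempty_addEquiv_of_ker_eq {A B C : Type*} [AddCommGroup A] [AddCommGroup B]
    [AddCommGroup C] (f : A →+ B) (g : A →+ C) (hf : Function.Surjective f)
    (hg : Function.Surjective g) (h : f.ker = g.ker) : Nonempty (B ≃+ C) :=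
  ⟨((QuotientAddGroup.quotientKerEquivOfSurjective f hf).symm.trans
    (QuotientAddGroup.quotientAddEquivOfEq h)).trans
    (QuotientAddGroup.quotientKerEquivOfSurjective g hg)⟩

/-- For a family `h` of `n` nonzero vectors spanning a plane over `ℤ/p`, the families of linear
forms modulo those that agree on each `h i` with a fixed linear form. -/
theorem exists_surjective_hom_family {W : Type*} [AddCommGroup W] {p : ℕ} [Fact p.Prime]
    [Module (ZMod p) W] (hW : Module.finrank (ZMod p) W = 2) {n : ℕ} (h : Fin n → W)
    (h0 : ∀ i, h i ≠ 0) (hspan : ∀ ψ : W →+ ZMod p, (∀ i, ψ (h i) = 0) → ψ = 0) :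
    ∃ Q : (Fin n → W →+ ZMod p) →+ (Fin (n - 2) → ZMod p), Function.Surjective Q ∧
      ∀ φ, Q φ = 0 ↔ ∃ ψ : W →+ ZMod p, ∀ i, φ i (h i) = ψ (h i) := by
  have : FiniteDimensional (ZMod p) W := Module.finite_of_finrank_pos (by omega)
  let ev : Module.Dual (ZMod p) W →ₗ[ZMod p] (Fin n → ZMod p) :=
    LinearMap.pi fun i => Module.Dual.eval (ZMod p) W (h i)
  have hev : Function.Injective ev := by
    rw [injective_iff_map_eq_zero]
    intro ψ hψ
    have := hspan ψ.toAddMonoidHom fun i => congrFun hψ i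
    ext x
    exact DFunLike.congr_fun this x
  have hD : Module.finrank (ZMod p) (LinearMap.range ev) = 2 := by
    rw [LinearMap.finrank_range_of_inj hev, Subspace.dual_finrank_eq, hW]
  -- The rank equation forces `2 ≤ n`, so the truncated subtraction is exact.
  have hQ : Module.finrank (ZMod p) ((Fin n → ZMod p) ⧸ LinearMap.range ev) = n - 2 := by
    have := Submodule.finrank_quotient_add_finrank (LinearMap.range ev)
    rw [hD, Module.finrank_fin_fun] at this
    omega
  let e : ((Fin n → ZMod p) ⧸ LinearMap.range ev) ≃ₗ[ZMod p] (Fin (n - 2) → ZMod p) :=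
    LinearEquiv.ofFinrankEq _ _ (by rw [hQ, Module.finrank_fin_fun])
  let F : (Fin n → W →+ ZMod p) →+ (Fin n → ZMod p) :=
    AddMonoidHom.mk' (fun φ i => φ i (h i)) fun _ _ => rfl
  refine ⟨(e.toAddEquiv.toAddMonoidHom.comp (LinearMap.range ev).mkQ.toAddMonoidHom).comp F, ?_, ?_⟩
  · refine (e.surjective.comp (Submodule.mkQ_surjective _)).comp fun v => ?_
    -- A nonzero vector takes any prescribed value under a suitable linear form, and the forms are
    -- chosen independently for each `i`.
    have hex : ∀ i, ∃ φ : W →+ ZMod p, φ (h i) = v i := by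
      intro i
      obtain ⟨f, hf⟩ : ∃ f : Module.Dual (ZMod p) W, f (h i) ≠ 0 := by
        by_contra! hf
        exact h0 i ((Module.forall_dual_apply_eq_zero_iff _ _).1 hf)
      refine ⟨((v i * (f (h i))⁻¹) • f).toAddMonoidHom, ?_⟩
      change (v i * (f (h i))⁻¹) * f (h i) = v i
      rw [mul_assoc, inv_mul_cancel₀ hf, mul_one]
    choose φ hφ using hex
    exact ⟨φ, funext hφ⟩
  · intro φ
    change e ((LinearMap.range ev).mkQ (F φ)) = 0 ↔ _
    rw [LinearEquiv.map_eq_zero_iff, Submodule.mkQ_apply, Submodule.Quotient.mk_eq_zero]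
    constructor
    · rintro ⟨ψ, hψ⟩
      exact ⟨ψ.toAddMonoidHom, fun i => (congrFun hψ i).symm⟩
    · rintro ⟨ψ, hψ⟩
      exact ⟨ψ.toZModLinearMap p, funext fun i => (hψ i).symm⟩

theorem card_dvd_of_iInf_eq_bot {G : Type*} [CommGroup G] {n : ℕ} {H : Fin n → Subgroup G} {p : ℕ}
    (hindex : ∀ i, (H i).index = p) (hinf : ⨅ i, H i = ⊥)
    (hn : n < 2) : Nat.card G ∣ p := by
  rw [← Subgroup.index_bot, ← hinf]
  interval_cases n
  · rw [iInf_of_empty, Subgroup.index_top]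
    exact one_dvd p
  · rw [iInf_unique, hindex]

/-! ### Computation of Sha for a permutation quotient -/

section Main

variable {G : Type*} [CommGroup G] [Finite G] {X : Type*} [MulAction G X] {M : Type*}
  [AddCommGroup M] [DistribMulAction G M] {π : (X → ℤ) →+ M} {n : ℕ}
  {s : X → Fin n} {H : Fin n → Subgroup G} {p : ℕ} [Fact p.Prime]

theorem shaTwoCycl_of_permutationQuotient (hπ : IsPermutationQuotient G π)
    (hexp : ∀ g : G, g ^ p = 1) (hs : ∀ (g : G) x, s (g • x) = s x)
    (hst : ∀ (g : G) x, g • x = x ↔ g ∈ H (s x)) (hsurj : Function.Surjective s)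
    (hindex : ∀ i, (H i).index = p) (hinj : Function.Injective H) (hinf : ⨅ i, H i = ⊥) :
    (¬ Nonempty (G ≃* Multiplicative (ZMod p) × Multiplicative (ZMod p)) →
      ShaTwoCycl G M = ⊥) ∧
    (Nonempty (G ≃* Multiplicative (ZMod p) × Multiplicative (ZMod p)) →
      2 ≤ n ∧ Nonempty (ShaTwoCycl G M ≃+ (Fin (n - 2) → ZMod p))) := by
  have hp : p.Prime := Fact.out
  have hgen : ∀ i j, i ≠ j → H i ⊔ H j = ⊤ := fun i j hij =>
    Subgroup.sup_eq_top_of_index_prime hp (hindex i)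
      (Subgroup.not_le_of_index_eq ((hindex _).trans (hindex _).symm) (hinj.ne hij))
  constructor
  · intro hG
    by_cases hn : n < 2
    · have : IsCyclic G := by
        rcases (Nat.dvd_prime hp).1 (card_dvd_of_iInf_eq_bot hindex hinf hn) with h | h
        · have := (Nat.card_eq_one_iff_unique.1 h).1
          exact isCyclic_of_subsingleton
        · exact isCyclic_of_prime_card h
      exact shaTwoCycl_eq_bot_of_isCyclic
    · have : Nonempty (Fin n) := ⟨⟨0, by omega⟩⟩
      have hne : (⟨0, by omega⟩ : Fin n) ≠ ⟨1, by omega⟩ := by simp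
      -- Two subgroups of index `p` that generate `G` and meet trivially are complements, so each
      -- has order `p` and `G` has order `p²`, the excluded case.
      have hU : H ⟨0, by omega⟩ ⊓ H ⟨1, by omega⟩ ≠ ⊥ := by
        intro hU
        refine hG (nonempty_mulEquiv_zmod_prod hexp ?_)
        have h1 := Subgroup.isComplement'_of_disjoint_and_mul_eq_univ (disjoint_iff.2 hU)
          (by rw [← Subgroup.mul_normal, hgen _ _ hne]; rfl)
        have h2 := h1.index_eq_card
        rw [← h1.card_mul_card, ← h2, hindex, ← h1.symm.index_eq_card, hindex]
      rw [eq_bot_iff]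
      intro γ hγ
      obtain ⟨φ, hφ, rfl⟩ := exists_carryClass_eq_of_mem_shaTwoCycl hπ hexp hs hst hsurj
        (hgen _ _ hne) γ hγ
      exact AddSubgroup.mem_bot.2 ((carryClass_eq_zero_iff hπ hexp hs hst hsurj φ).2
        (exists_hom_of_compatible hp hindex hinj hinf hne hU φ hφ))
  · rintro ⟨e⟩
    have hcard := card_of_mulEquiv_zmod_prod e
    have hn : 2 ≤ n := by
      by_contra! hn
      have := Nat.le_of_dvd hp.pos (card_dvd_of_iInf_eq_bot hindex hinf hn)
      rw [hcard] at this
      nlinarith [hp.two_le]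
    refine ⟨hn, ?_⟩
    have : Nonempty (Fin n) := ⟨⟨0, by omega⟩⟩
    have hne : (⟨0, by omega⟩ : Fin n) ≠ ⟨1, by omega⟩ := by simp
    have hcardH : ∀ i, Nat.card (H i) = p := by
      intro i
      have := (H i).card_mul_index
      rw [hindex, hcard] at this
      exact Nat.eq_of_mul_eq_mul_right hp.pos this
    have hex : ∀ i, ∃ h : G, h ≠ 1 ∧ H i = Subgroup.zpowers h := by
      intro i
      have : Nontrivial (H i) := Finite.one_lt_card_iff_nontrivial.1 (hcardH i ▸ hp.one_lt)
      obtain ⟨h, hh⟩ := exists_ne (1 : H i)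
      have hh' : (h : G) ≠ 1 := fun e => hh (Subtype.ext e)
      refine ⟨h, hh', (Subgroup.eq_of_le_of_card_ge (Subgroup.zpowers_le.2 h.2) ?_).symm⟩
      rw [hcardH, Nat.card_zpowers, orderOf_eq_prime (hexp _) hh']
    choose h hh1 hHh using hex
    have hmem : ∀ i, h i ∈ H i := fun i => hHh i ▸ Subgroup.mem_zpowers (h i)
    -- Distinct subgroups of order `p` meet trivially, so compatibility of a family is automatic.
    have hdisj : ∀ i j, ∀ g ∈ H i, g ∈ H j → i ≠ j → g = 1 := by
      intro i j g hi hj hij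
      by_contra hg
      have h1 : ∀ i, g ∈ H i → H i = Subgroup.zpowers g := fun i hi =>
        (Subgroup.eq_of_le_of_card_ge (Subgroup.zpowers_le.2 hi)
          (by rw [hcardH, Nat.card_zpowers, orderOf_eq_prime (hexp _) hg])).symm
      exact hij (hinj ((h1 i hi).trans (h1 j hj).symm))
    have heq : ∀ i (φ ψ : Additive G →+ ZMod p),
        φ (Additive.ofMul (h i)) = ψ (Additive.ofMul (h i)) →
        ∀ g ∈ H i, φ (Additive.ofMul g) = ψ (Additive.ofMul g) := by
      intro i φ ψ hφψ g hg
      rw [hHh] at hg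
      obtain ⟨k, rfl⟩ := Subgroup.mem_zpowers_iff.1 hg
      rw [ofMul_zpow, map_zsmul, map_zsmul, hφψ]
    let _ : Module (ZMod p) (Additive G) := AddCommGroup.zmodModule fun g => hexp g.toMul
    obtain ⟨Q, hQ, hQ0⟩ := exists_surjective_hom_family (finrank_additive_eq_two (p := p) hcard)
      (fun i => Additive.ofMul (h i)) (fun i => hh1 i) (by
        intro ψ hψ
        refine AddMonoidHom.ext fun g => ?_
        obtain ⟨a, ha, b, hb, hab⟩ := Subgroup.mem_sup.1
          (hgen _ _ hne ▸ Subgroup.mem_top g.toMul)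
        have e : g = Additive.ofMul a + Additive.ofMul b := hab.symm
        rw [e, map_add, heq _ ψ 0 (hψ _) a ha, heq _ ψ 0 (hψ _) b hb, map_add])
    have hSha : ∀ φ : Fin n → Additive G →+ ZMod p,
        carryClass hπ hs φ ∈ ShaTwoCycl G M := by
      intro φ
      refine carryClass_mem_shaTwoCycl (p := p) hexp hπ hs (fun g x => (hst g x).1) φ ?_
      intro i j g hi hj
      by_cases hij : i = j
      · rw [hij]
      · rw [hdisj i j g hi hj hij, ofMul_one, map_zero, map_zero]
    -- Sha and `(ℤ/p)^(n-2)` are both quotients of the group of all families, by the same kernel: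
    -- agreement on `H i` amounts to agreement at its generator `h i`.
    refine nonempty_addEquiv_of_ker_eq ((carryClass hπ hs).codRestrict _ hSha) Q ?_ hQ ?_
    · rintro ⟨γ, hγ⟩
      obtain ⟨φ, -, hφ⟩ := exists_carryClass_eq_of_mem_shaTwoCycl hπ hexp hs hst hsurj
        (hgen _ _ hne) γ hγ
      exact ⟨φ, Subtype.ext hφ⟩
    · ext φ
      rw [AddMonoidHom.mem_ker, AddMonoidHom.mem_ker, hQ0]
      refine Subtype.ext_iff.trans ((carryClass_eq_zero_iff hπ hexp hs hst hsurj φ).trans ?_)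
      exact ⟨fun ⟨ψ, hψ⟩ => ⟨ψ, fun i => hψ i _ (hmem i)⟩,
        fun ⟨ψ, hψ⟩ => ⟨ψ, fun i => heq i _ _ (hψ i)⟩⟩

end Main

/-! ### Characters of powers of the multiplicative group -/

section MultiplicativeGroup

open LaurentPolynomial

variable {k K : Type u} [Field k] [Field K] [Algebra k K]

/-- The generic unit of the ring of Laurent polynomials. -/
noncomputable def laurentUnit (K : Type*) [Field K] : (K[T;T⁻¹])ˣ :=
  (isUnit_T (1 : ℤ)).unit

theorem laurentUnit_zpow (K : Type*) [Field K] (m : ℤ) :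
    ((laurentUnit K ^ m : (K[T;T⁻¹])ˣ) : K[T;T⁻¹]) = T m := by
  have h1 : ((laurentUnit K : (K[T;T⁻¹])ˣ) : K[T;T⁻¹]) = T 1 := rfl
  have h2 : ((laurentUnit K)⁻¹ : (K[T;T⁻¹])ˣ) = ((isUnit_T (-1 : ℤ)).unit : (K[T;T⁻¹])ˣ) := by
    rw [inv_eq_iff_mul_eq_one]
    ext1
    rw [Units.val_mul, h1, IsUnit.unit_spec, ← T_add]
    simp
  induction m using Int.induction_on with
  | zero => simp
  | succ i ih => rw [zpow_add_one, Units.val_mul, ih, h1, ← T_add]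
  | pred i ih => rw [zpow_sub_one, Units.val_mul, ih, h2, IsUnit.unit_spec, ← T_add, sub_eq_add_neg]

/-- A character of the multiplicative group is a power map. -/
theorem exists_exponent_of_natural
    (ψ : ∀ (R : Type u) [CommRing R] [Algebra k R], (K →ₐ[k] R) → (Rˣ →* Rˣ))
    (hψ : ∀ (R S : Type u) [CommRing R] [Algebra k R] [CommRing S] [Algebra k S]
      (f : K →ₐ[k] R) (φ : R →ₐ[k] S) (u : Rˣ),
      ψ S (φ.comp f) (Units.map (φ : R →* S) u) = Units.map (φ : R →* S) (ψ R f u)) :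
    ∃ m : ℤ, ∀ (R : Type u) [CommRing R] [Algebra k R] (f : K →ₐ[k] R) (u : Rˣ),
      ψ R f u = u ^ m := by
  let f₀ : K →ₐ[k] K[T;T⁻¹] := IsScalarTower.toAlgHom k K _
  set q : (K[T;T⁻¹])ˣ := ψ _ f₀ (laurentUnit K) with hq
  -- Naturality along the counit and the comultiplication makes the image of the generic unit
  -- group-like, hence a power of `T`. Every unit is a specialization of the generic one.
  have hgl : IsGroupLikeElem K (q : K[T;T⁻¹]) := by
    constructor
    · have h := hψ _ _ f₀ ((Bialgebra.counitAlgHom K K[T;T⁻¹]).restrictScalars k) (laurentUnit K)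
      have h1 : Units.map (((Bialgebra.counitAlgHom K K[T;T⁻¹]).restrictScalars k :
          K[T;T⁻¹] →ₐ[k] K) : K[T;T⁻¹] →* K) (laurentUnit K) = 1 := by
        ext1
        exact counit_T (R := K) (A := K) 1
      rw [h1, map_one] at h
      exact (congrArg Units.val h).symm
    · let c : K[T;T⁻¹] →ₐ[k] K[T;T⁻¹] ⊗[K] K[T;T⁻¹] :=
        (Bialgebra.comulAlgHom K K[T;T⁻¹]).restrictScalars k
      let l : K[T;T⁻¹] →ₐ[k] K[T;T⁻¹] ⊗[K] K[T;T⁻¹] :=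
        (Algebra.TensorProduct.includeLeft : K[T;T⁻¹] →ₐ[K] _).restrictScalars k
      let r : K[T;T⁻¹] →ₐ[k] K[T;T⁻¹] ⊗[K] K[T;T⁻¹] :=
        (Algebra.TensorProduct.includeRight : K[T;T⁻¹] →ₐ[K] _).restrictScalars k
      have hc := hψ _ _ f₀ c (laurentUnit K)
      have hl := hψ _ _ f₀ l (laurentUnit K)
      have hr := hψ _ _ f₀ r (laurentUnit K)
      have e1 : c.comp f₀ = l.comp f₀ := by
        ext x
        exact (Bialgebra.comulAlgHom K K[T;T⁻¹]).commutes x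
      have e2 : r.comp f₀ = l.comp f₀ := by
        ext x
        exact (Algebra.TensorProduct.includeRight : K[T;T⁻¹] →ₐ[K] K[T;T⁻¹] ⊗[K] K[T;T⁻¹]).commutes x
      have e3 : Units.map (c : K[T;T⁻¹] →* K[T;T⁻¹] ⊗[K] K[T;T⁻¹]) (laurentUnit K) =
          Units.map (l : K[T;T⁻¹] →* K[T;T⁻¹] ⊗[K] K[T;T⁻¹]) (laurentUnit K) *
          Units.map (r : K[T;T⁻¹] →* K[T;T⁻¹] ⊗[K] K[T;T⁻¹]) (laurentUnit K) := by
        ext1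
        refine (comul_T (R := K) (A := K) 1).trans ?_
        change (T 1 : K[T;T⁻¹]) ⊗ₜ[K] (T 1 : K[T;T⁻¹]) = (T 1 ⊗ₜ[K] 1) * (1 ⊗ₜ[K] T 1)
        rw [Algebra.TensorProduct.tmul_mul_tmul, mul_one, one_mul]
      rw [e1, e3, map_mul, hl, ← e2, hr] at hc
      refine (congrArg Units.val hc).symm.trans ?_
      change ((q : K[T;T⁻¹]) ⊗ₜ[K] (1 : K[T;T⁻¹])) * ((1 : K[T;T⁻¹]) ⊗ₜ[K] (q : K[T;T⁻¹])) = _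
      rw [Algebra.TensorProduct.tmul_mul_tmul, mul_one, one_mul]
  obtain ⟨m, hm⟩ := AddMonoidAlgebra.isGroupLikeElem_iff_mem_range_of.1 hgl
  have hqm : q = laurentUnit K ^ m.toAdd := by
    ext1
    rw [laurentUnit_zpow, ← hm]
    rfl
  refine ⟨m.toAdd, fun R _ _ f u => ?_⟩
  let φ : K[T;T⁻¹] →ₐ[k] R :=
    { LaurentPolynomial.eval₂ (f : K →+* R) u with
      commutes' := by
        intro a
        change LaurentPolynomial.eval₂ (f : K →+* R) u (algebraMap k K[T;T⁻¹] a) = _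
        rw [IsScalarTower.algebraMap_apply k K K[T;T⁻¹]]
        refine (LaurentPolynomial.eval₂_C _ _ _).trans ?_
        exact f.commutes a }
  have h := hψ _ _ f₀ φ (laurentUnit K)
  have e1 : φ.comp f₀ = f := by
    ext x
    exact LaurentPolynomial.eval₂_C _ _ _
  have e2 : Units.map (φ : K[T;T⁻¹] →* R) (laurentUnit K) = u := by
    ext1
    change LaurentPolynomial.eval₂ (f : K →+* R) u (T ((1 : ℕ) : ℤ)) = u
    rw [LaurentPolynomial.eval₂_T_n, pow_one]
  rw [e1, e2, ← hq, hqm, map_zpow, e2] at h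
  exact h

/-- A character of a power of the multiplicative group is a monomial. -/
theorem exists_exponents_of_natural {X : Type*} [Fintype X]
    (χ : ∀ (R : Type u) [CommRing R] [Algebra k R], (K →ₐ[k] R) → ((X → Rˣ) →* Rˣ))
    (hχ : ∀ (R S : Type u) [CommRing R] [Algebra k R] [CommRing S] [Algebra k S]
      (f : K →ₐ[k] R) (φ : R →ₐ[k] S) (u : X → Rˣ),
      χ S (φ.comp f) (fun x => Units.map (φ : R →* S) (u x)) = Units.map (φ : R →* S) (χ R f u)) :
    ∃ m : X → ℤ, ∀ (R : Type u) [CommRing R] [Algebra k R] (f : K →ₐ[k] R) (u : X → Rˣ),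
      χ R f u = ∏ x, u x ^ m x := by
  classical
  have h := fun x => exists_exponent_of_natural (k := k) (K := K)
    (fun R _ _ f => (χ R f).comp (MonoidHom.mulSingle (fun _ : X => Rˣ) x)) (by
      intro R S _ _ _ _ f φ u
      refine Eq.trans ?_ (hχ R S f φ (Pi.mulSingle x u))
      refine congrArg (χ S (φ.comp f)) (funext fun y => ?_)
      exact (Pi.apply_mulSingle (fun _ (v : Rˣ) => Units.map (φ : R →* S) v)
        (fun _ => map_one _) x u y).symm)
  choose m hm using h
  refine ⟨m, fun R _ _ f u => ?_⟩
  conv_lhs => rw [← Finset.univ_prod_mulSingle u]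
  rw [map_prod]
  exact Finset.prod_congr rfl fun x _ => hm x R f (u x)

end MultiplicativeGroup

/-! ### Split norm tori -/

section Coordinates

variable {k L K : Type u} [Field k] [CommRing L] [Algebra k L] [Field K] [Algebra k K]

/-- The coordinate of `R ⊗ L` given by a homomorphism `L → K` and a `K`-algebra `f : K → R`. -/
noncomputable def tensorCoord {R : Type u} [CommRing R] [Algebra k R] (f : K →ₐ[k] R)
    (χ : L →ₐ[k] K) : R ⊗[k] L →ₐ[R] R :=
  Algebra.TensorProduct.lift (AlgHom.id R R) (f.comp χ) fun _ _ => Commute.all _ _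

theorem tensorCoord_tmul {R : Type u} [CommRing R] [Algebra k R] (f : K →ₐ[k] R)
    (χ : L →ₐ[k] K) (r : R) (l : L) : tensorCoord f χ (r ⊗ₜ l) = r * f (χ l) := by
  simp [tensorCoord]

theorem tensorCoord_baseChangeMap {R S : Type u} [CommRing R] [Algebra k R] [CommRing S]
    [Algebra k S] (f : K →ₐ[k] R) (φ : R →ₐ[k] S) (χ : L →ₐ[k] K) (y : R ⊗[k] L) :
    tensorCoord (φ.comp f) χ (baseChangeMap k L φ y) = φ (tensorCoord f χ y) := by
  induction y using TensorProduct.induction_on with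
  | zero => simp
  | tmul r l => simp [tensorCoord_tmul]
  | add y z hy hz => rw [map_add, map_add, map_add, map_add, hy, hz]

variable {X : Type*} (ev : X → (L →ₐ[k] K))

/-- The coordinates of `R ⊗ L` given by a family of homomorphisms `L → K`. -/
noncomputable def tensorCoords {R : Type u} [CommRing R] [Algebra k R] (f : K →ₐ[k] R) :
    R ⊗[k] L →ₐ[R] (X → R) :=
  AlgHom.pi fun x => tensorCoord f (ev x)

/-- The coordinates of the points of the norm torus. -/
noncomputable def torusCoords {R : Type u} [CommRing R] [Algebra k R] (f : K →ₐ[k] R) :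
    normTorus k L R →* (X → Rˣ) :=
  MonoidHom.pi fun x =>
    (Units.map (tensorCoord f (ev x) : R ⊗[k] L →* R)).comp (normTorus k L R).subtype

variable {ev}

theorem torusCoords_apply_coe {R : Type u} [CommRing R] [Algebra k R] (f : K →ₐ[k] R)
    (t : normTorus k L R) (x : X) :
    (torusCoords ev f t x : R) = tensorCoord f (ev x) ((t : (R ⊗[k] L)ˣ) : R ⊗[k] L) := rfl

variable [Module.Finite k L]

theorem torusCoords_normTorusMap {R S : Type u} [CommRing R] [Algebra k R] [CommRing S]
    [Algebra k S] (f : K →ₐ[k] R) (φ : R →ₐ[k] S) (t : normTorus k L R) (x : X) :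
    torusCoords ev (φ.comp f) (normTorusMap k L φ t) x =
      Units.map (φ : R →* S) (torusCoords ev f t x) :=
  Units.ext (tensorCoord_baseChangeMap f φ (ev x) _)

theorem TorusCharacter.ext_of_eval_eq {χ ψ : TorusCharacter k L K}
    (h : ∀ (R : Type u) [CommRing R] [Algebra k R] (f : K →ₐ[k] R) (t : normTorus k L R),
      χ.eval R f t = ψ.eval R f t) : χ = ψ := by
  ext R _ _ f t
  exact congrArg Units.val (h R f t)

variable [Fintype X]

/-- `L ⊗ K` is split by the family `ev` of all homomorphisms `L → K`. -/
structure IsSplitBy (ev : X → (L →ₐ[k] K)) : Prop where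
  injective : Function.Injective ev
  card : Fintype.card X = Module.finrank k L

/-- By Dedekind's independence of homomorphisms the square matrix `ev x (b j)` is invertible over
`K`, and this persists after base change along `f`. -/
theorem IsSplitBy.bijective_tensorCoords (h : IsSplitBy ev) {R : Type u} [CommRing R] [Algebra k R]
    (f : K →ₐ[k] R) : Function.Bijective (tensorCoords ev f) := by
  classical
  let e : Fin (Module.finrank k L) ≃ X := (finCongr h.card.symm).trans (Fintype.equivFin X).symm
  let b : Module.Basis X k L := (Module.finBasis k L).reindex e
  let A : Matrix X X K := Matrix.of fun x j => ev x (b j)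
  have hA : IsUnit A := by
    rw [← Matrix.linearIndependent_rows_iff_isUnit, Fintype.linearIndependent_iff]
    intro c hc x
    have hli := (linearIndependent_algHom_toLinearMap k L K).comp ev h.injective
    rw [Fintype.linearIndependent_iff] at hli
    refine hli c ?_ x
    refine b.ext fun j => ?_
    have := congrFun hc j
    simpa [A, LinearMap.sum_apply] using this
  have hM : LinearMap.toMatrix (b.baseChange R) (Pi.basisFun R X)
      (tensorCoords ev f).toLinearMap = A.map f := by
    ext x j
    rw [LinearMap.toMatrix_apply]
    simp [A, tensorCoords, tensorCoord_tmul]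
  have hdet : IsUnit (LinearMap.toMatrix (b.baseChange R) (Pi.basisFun R X)
      (tensorCoords ev f).toLinearMap).det := by
    rw [hM]
    have := ((Matrix.isUnit_iff_isUnit_det A).1 hA).map f
    rwa [AlgHom.map_det] at this
  exact (LinearEquiv.ofIsUnitDet hdet).bijective

theorem IsSplitBy.norm_eq_prod (h : IsSplitBy ev) {R : Type u} [CommRing R] [Algebra k R]
    (f : K →ₐ[k] R) (y : R ⊗[k] L) : Algebra.norm R y = ∏ x, tensorCoord f (ev x) y := by
  classical
  let e := AlgEquiv.ofBijective (tensorCoords ev f) (h.bijective_tensorCoords f)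
  rw [Algebra.norm_eq_matrix_det ((Pi.basisFun R X).map e.symm.toLinearEquiv)]
  have : Algebra.leftMulMatrix ((Pi.basisFun R X).map e.symm.toLinearEquiv) y =
      Matrix.diagonal fun x => tensorCoord f (ev x) y := by
    ext i j
    rw [Algebra.leftMulMatrix_eq_repr_mul, Module.Basis.map_repr, Module.Basis.map_apply]
    change ((Pi.basisFun R X).repr (e (y * e.symm (Pi.basisFun R X j)))) i = _
    rw [map_mul, AlgEquiv.apply_symm_apply, Pi.basisFun_repr, Pi.basisFun_apply, Pi.mul_apply,
      Matrix.diagonal_apply, Pi.single_apply, mul_ite, mul_one, mul_zero]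
    rfl
  rw [this, Matrix.det_diagonal]

theorem IsSplitBy.torusCoords_injective (h : IsSplitBy ev) {R : Type u} [CommRing R] [Algebra k R]
    (f : K →ₐ[k] R) : Function.Injective (torusCoords ev f) := by
  intro t t' htt'
  refine Subtype.ext (Units.ext ((h.bijective_tensorCoords f).1 (funext fun x => ?_)))
  exact congrArg Units.val (congrFun htt' x)

theorem IsSplitBy.prod_torusCoords (h : IsSplitBy ev) {R : Type u} [CommRing R] [Algebra k R]
    (f : K →ₐ[k] R) (t : normTorus k L R) : ∏ x, torusCoords ev f t x = 1 := by
  ext1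
  rw [Units.coe_prod]
  exact (h.norm_eq_prod f _).symm.trans (congrArg Units.val t.2)

theorem IsSplitBy.exists_torusCoords_eq (h : IsSplitBy ev) {R : Type u} [CommRing R] [Algebra k R]
    (f : K →ₐ[k] R) (u : X → Rˣ) (hu : ∏ x, u x = 1) :
    ∃ t : normTorus k L R, torusCoords ev f t = u := by
  let e := AlgEquiv.ofBijective (tensorCoords ev f) (h.bijective_tensorCoords f)
  let y : (R ⊗[k] L)ˣ := Units.map (e.symm : (X → R) →* R ⊗[k] L) (MulEquiv.piUnits.symm u)
  have hy : ∀ x, tensorCoord f (ev x) (y : R ⊗[k] L) = u x := by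
    intro x
    exact congrFun (e.apply_symm_apply fun x => (u x : R)) x
  refine ⟨⟨y, ?_⟩, funext fun x => Units.ext (hy x)⟩
  rw [normTorus, MonoidHom.mem_ker]
  ext1
  refine (h.norm_eq_prod f (y : R ⊗[k] L)).trans ?_
  simp only [hy]
  rw [← Units.coe_prod, hu]

open Classical in
/-- The point of the norm torus whose coordinates outside `x₀` are given. -/
theorem IsSplitBy.exists_section (h : IsSplitBy ev) (x₀ : X) {R : Type u} [CommRing R] [Algebra k R]
    (f : K →ₐ[k] R) : ∃ τ : (X → Rˣ) →* normTorus k L R, ∀ u,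
      torusCoords ev f (τ u) = u * Pi.mulSingle x₀ (∏ x, u x)⁻¹ := by
  have hex : ∀ u : X → Rˣ, ∃ t : normTorus k L R,
      torusCoords ev f t = u * Pi.mulSingle x₀ (∏ x, u x)⁻¹ := by
    intro u
    apply h.exists_torusCoords_eq f
    simp [Finset.prod_mul_distrib]
  choose τ hτ using hex
  have hmul : ∀ u v, τ (u * v) = τ u * τ v := by
    intro u v
    apply h.torusCoords_injective f
    rw [map_mul, hτ, hτ, hτ, mul_mul_mul_comm, ← Pi.mulSingle_mul]
    simp only [Pi.mul_apply, Finset.prod_mul_distrib, mul_inv]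
  exact ⟨MonoidHom.mk' τ hmul, hτ⟩

/-- The norm torus of a split algebra is split. -/
theorem IsSplitBy.splitsNormTorus (h : IsSplitBy ev) : SplitsNormTorus k L K := by
  classical
  rcases isEmpty_or_nonempty X with hX | ⟨⟨x₀⟩⟩
  · refine ⟨0, ⟨⟨fun R _ _ f => MulEquiv.ofBijective (1 : normTorus k L R →* (Fin 0 → Rˣ))
      ⟨fun t t' _ => h.torusCoords_injective f (funext fun x => hX.elim x),
        fun u => ⟨1, Subsingleton.elim _ _⟩⟩, fun R S _ _ _ _ f φ t i => i.elim0⟩⟩⟩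
  · let e := Fintype.equivFin {x : X // x ≠ x₀}
    let c : ∀ (R : Type u) [CommRing R] [Algebra k R], (K →ₐ[k] R) →
        (normTorus k L R →* (Fin (Fintype.card {x : X // x ≠ x₀}) → Rˣ)) := fun R _ _ f =>
      MonoidHom.pi fun i => (Pi.evalMonoidHom (fun _ : X => Rˣ) (e.symm i : X)).comp
        (torusCoords ev f)
    have hc : ∀ (R : Type u) [CommRing R] [Algebra k R] (f : K →ₐ[k] R),
        Function.Bijective (c R f) := by
      intro R _ _ f
      constructor
      · intro t t' htt'
        have h1 : ∀ x, x ≠ x₀ → torusCoords ev f t x = torusCoords ev f t' x := by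
          intro x hx
          have : torusCoords ev f t (e.symm (e ⟨x, hx⟩) : X) =
            torusCoords ev f t' (e.symm (e ⟨x, hx⟩) : X) := congrFun htt' (e ⟨x, hx⟩)
          rwa [e.symm_apply_apply] at this
        refine h.torusCoords_injective f (funext fun x => ?_)
        by_cases hx : x = x₀
        · subst hx
          have h2 := (h.prod_torusCoords f t).trans (h.prod_torusCoords f t').symm
          rw [← Finset.mul_prod_erase _ _ (Finset.mem_univ x),
            ← Finset.mul_prod_erase _ _ (Finset.mem_univ x),
            Finset.prod_congr rfl fun y hy => h1 y (Finset.ne_of_mem_erase hy)] at h2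
          exact mul_right_cancel h2
        · exact h1 x hx
      · intro v
        obtain ⟨τ, hτ⟩ := h.exists_section x₀ f
        refine ⟨τ fun x => if hx : x = x₀ then 1 else v (e ⟨x, hx⟩), funext fun i => ?_⟩
        change torusCoords ev f (τ _) (e.symm i : X) = v i
        rw [hτ, Pi.mul_apply, Pi.mulSingle_eq_of_ne (e.symm i).2, mul_one, dif_neg (e.symm i).2]
        simp
    exact ⟨_, ⟨⟨fun R _ _ f => MulEquiv.ofBijective (c R f) (hc R f),
      fun R S _ _ _ _ f φ t i => torusCoords_normTorusMap f φ t _⟩⟩⟩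

variable (ev) in
/-- The characters of the norm torus given by monomials in the coordinates. -/
noncomputable def monomialCharacter : (X → ℤ) →+ TorusCharacter k L K :=
  AddMonoidHom.mk' (fun m =>
    { eval := fun R _ _ f =>
        { toFun := fun t => ∏ x, torusCoords ev f t x ^ m x
          map_one' := by simp
          map_mul' := fun t t' => by
            simp only [map_mul, Pi.mul_apply, mul_zpow, Finset.prod_mul_distrib] }
      natural := by
        intro R S _ _ _ _ f φ t
        change ∏ x, torusCoords ev (φ.comp f) (normTorusMap k L φ t) x ^ m x =
          Units.map (φ : R →* S) (∏ x, torusCoords ev f t x ^ m x)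
        simp only [torusCoords_normTorusMap, map_prod, map_zpow] }) (by
    intro m m'
    refine TorusCharacter.ext_of_eval_eq fun R _ _ f t => ?_
    change ∏ x, torusCoords ev f t x ^ (m x + m' x) =
      (∏ x, torusCoords ev f t x ^ m x) * ∏ x, torusCoords ev f t x ^ m' x
    simp only [zpow_add, Finset.prod_mul_distrib])

theorem monomialCharacter_eval (m : X → ℤ) {R : Type u} [CommRing R] [Algebra k R]
    (f : K →ₐ[k] R) (t : normTorus k L R) :
    (monomialCharacter ev m).eval R f t = ∏ x, torusCoords ev f t x ^ m x := rfl

theorem IsSplitBy.monomialCharacter_surjective (h : IsSplitBy ev) :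
    Function.Surjective (monomialCharacter ev) := by
  classical
  intro χ
  rcases isEmpty_or_nonempty X with hX | ⟨⟨x₀⟩⟩
  · refine ⟨0, TorusCharacter.ext_of_eval_eq fun R _ _ f t => ?_⟩
    have : t = 1 := h.torusCoords_injective f (funext fun x => hX.elim x)
    rw [this, map_one, map_one]
  · have hsec := fun (R : Type u) [CommRing R] [Algebra k R] (f : K →ₐ[k] R) =>
      h.exists_section x₀ f
    choose τ hτ using hsec
    obtain ⟨m, hm⟩ := exists_exponents_of_natural (k := k) (K := K) (X := X)
      (fun R _ _ f => (χ.eval R f).comp (τ R f)) (by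
        intro R S _ _ _ _ f φ u
        have e : τ S (φ.comp f) (fun x => Units.map (φ : R →* S) (u x)) =
            normTorusMap k L φ (τ R f u) := by
          apply h.torusCoords_injective (φ.comp f)
          funext x
          rw [torusCoords_normTorusMap, hτ, hτ, Pi.mul_apply, Pi.mul_apply, map_mul,
            ← map_prod, ← map_inv]
          congr 1
          exact (Pi.apply_mulSingle (fun _ (v : Rˣ) => Units.map (φ : R →* S) v)
            (fun _ => map_one _) x₀ _ x).symm
        change χ.eval S (φ.comp f) (τ S (φ.comp f) _) = _
        rw [e, χ.natural]
        rfl)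
    -- The map `τ` from the full power of the multiplicative group corrects only the coordinate at
    -- `x₀`. It sends the coordinates of a point `t` back to `t`, since their product is already 1.
    refine ⟨m, TorusCharacter.ext_of_eval_eq fun R _ _ f t => ?_⟩
    rw [monomialCharacter_eval, ← hm R f]
    change χ.eval R f (τ R f _) = _
    congr 1
    apply h.torusCoords_injective f
    rw [hτ, h.prod_torusCoords, inv_one, Pi.mulSingle_one, mul_one]

theorem IsSplitBy.monomialCharacter_eq_zero_iff (h : IsSplitBy ev) (m : X → ℤ) :
    monomialCharacter ev m = 0 ↔ ∀ x y, m x = m y := by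
  classical
  constructor
  · intro hm x y
    by_cases hxy : x = y
    · rw [hxy]
    let f : K →ₐ[k] LaurentPolynomial K := IsScalarTower.toAlgHom k K _
    -- Test on the point with coordinate `T` at `x`, `T⁻¹` at `y` and 1 elsewhere: the character
    -- takes the value `T ^ (m x - m y)`.
    obtain ⟨t, ht⟩ := h.exists_torusCoords_eq f
      (Pi.mulSingle x (laurentUnit K) * Pi.mulSingle y (laurentUnit K)⁻¹) (by
        simp [Finset.prod_mul_distrib])
    have h1 : (monomialCharacter ev m).eval _ f t = 1 := by rw [hm]; rfl
    rw [monomialCharacter_eval, ht] at h1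
    have h2 : ∀ z, (Pi.mulSingle x (laurentUnit K) * Pi.mulSingle y (laurentUnit K)⁻¹ :
        X → (LaurentPolynomial K)ˣ) z ^ m z =
        Pi.mulSingle (M := fun _ => (LaurentPolynomial K)ˣ) x (laurentUnit K ^ m x) z *
        Pi.mulSingle (M := fun _ => (LaurentPolynomial K)ˣ) y (laurentUnit K ^ (-m y)) z := by
      intro z
      rw [Pi.mul_apply, mul_zpow]
      congr 1
      · by_cases hz : z = x
        · subst hz; simp
        · simp [Pi.mulSingle_eq_of_ne hz]
      · by_cases hz : z = y
        · subst hz; simp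
        · simp [Pi.mulSingle_eq_of_ne hz]
    simp only [h2, Finset.prod_mul_distrib, Finset.prod_pi_mulSingle', Finset.mem_univ, if_true] at h1
    rw [← zpow_add] at h1
    have h3 := congrArg Units.val h1
    rw [laurentUnit_zpow, Units.val_one, ← LaurentPolynomial.T_zero] at h3
    have h4 : Multiplicative.ofAdd (m x + -m y) = Multiplicative.ofAdd 0 :=
      AddMonoidAlgebra.of_injective h3
    have h5 : m x + -m y = 0 := Multiplicative.ofAdd.injective h4
    omega
  · intro hm
    refine TorusCharacter.ext_of_eval_eq fun R _ _ f t => ?_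
    rw [monomialCharacter_eval]
    rcases isEmpty_or_nonempty X with hX | ⟨⟨x₀⟩⟩
    · rw [Finset.univ_eq_empty, Finset.prod_empty]
      rfl
    · rw [Finset.prod_congr rfl fun x _ => by rw [hm x x₀], Finset.prod_zpow,
        h.prod_torusCoords, one_zpow]
      rfl

theorem IsSplitBy.isPermutationQuotient (h : IsSplitBy ev) [MulAction (K ≃ₐ[k] K) X]
    (hev : ∀ (σ : K ≃ₐ[k] K) x, ev (σ • x) = (σ : K →ₐ[k] K).comp (ev x)) :
    IsPermutationQuotient (K ≃ₐ[k] K) (monomialCharacter ev) where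
  surjective := h.monomialCharacter_surjective
  map_eq_zero_iff := h.monomialCharacter_eq_zero_iff
  map_translate := by
    intro σ m
    refine TorusCharacter.ext_of_eval_eq fun R _ _ f t => ?_
    change _ = (monomialCharacter ev m).eval R (f.comp (σ : K →ₐ[k] K)) t
    rw [monomialCharacter_eval, monomialCharacter_eval,
      ← Equiv.prod_comp (MulAction.toPerm σ) fun x => torusCoords ev f t x ^ m (σ⁻¹ • x)]
    refine Finset.prod_congr rfl fun x _ => ?_
    rw [MulAction.toPerm_apply, inv_smul_smul]
    congr 1
    ext1
    rw [torusCoords_apply_coe, torusCoords_apply_coe, hev]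
    rfl

/-- The automorphisms of `K` over a subfield that splits the norm torus act trivially on the
characters over `K`. -/
theorem smul_torusCharacter_eq_self {E : Type u} [Field E] [Algebra k E]
    (hE : SplitsNormTorus k L E) (i : E →ₐ[k] K) (σ : K ≃ₐ[k] K)
    (hσ : (σ : K →ₐ[k] K).comp i = i) (χ : TorusCharacter k L K) : σ • χ = χ := by
  obtain ⟨r, ⟨T⟩⟩ := hE
  -- In the coordinates of a splitting over `E`, `χ` is a monomial, so its value depends on `f` only
  -- through `f.comp i`, which `σ` does not change.
  obtain ⟨m, hm⟩ := exists_exponents_of_natural (k := k) (K := K)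
    (fun R _ _ f => (χ.eval R f).comp (T.equiv R (f.comp i)).symm.toMonoidHom) (by
      intro R S _ _ _ _ f φ u
      have e : (T.equiv S ((φ.comp f).comp i)).symm (fun x => Units.map (φ : R →* S) (u x)) =
          normTorusMap k L φ ((T.equiv R (f.comp i)).symm u) := by
        rw [MulEquiv.symm_apply_eq]
        funext x
        have := T.natural R S (f.comp i) φ ((T.equiv R (f.comp i)).symm u) x
        rw [MulEquiv.apply_symm_apply] at this
        exact this.symm
      change χ.eval S (φ.comp f) ((T.equiv S ((φ.comp f).comp i)).symm _) = _
      rw [e, χ.natural]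
      rfl)
  have hχ : ∀ (R : Type u) [CommRing R] [Algebra k R] (f : K →ₐ[k] R) (t : normTorus k L R),
      χ.eval R f t = ∏ x, T.equiv R (f.comp i) t x ^ m x := by
    intro R _ _ f t
    rw [← hm]
    change _ = χ.eval R f ((T.equiv R (f.comp i)).symm (T.equiv R (f.comp i) t))
    rw [MulEquiv.symm_apply_apply]
  refine TorusCharacter.ext_of_eval_eq fun R _ _ f t => ?_
  change χ.eval R (f.comp (σ : K →ₐ[k] K)) t = _
  rw [hχ, hχ, AlgHom.comp_assoc, hσ]

/-- The automorphisms of `K` over a subfield that splits the norm torus fix the homomorphisms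
`L → K`. -/
theorem IsSplitBy.comp_eq_of_splits (h : IsSplitBy ev) [MulAction (K ≃ₐ[k] K) X]
    (hev : ∀ (σ : K ≃ₐ[k] K) x, ev (σ • x) = (σ : K →ₐ[k] K).comp (ev x))
    {E : Type u} [Field E] [Algebra k E]
    (hE : SplitsNormTorus k L E) (i : E →ₐ[k] K) (σ : K ≃ₐ[k] K)
    (hσ : (σ : K →ₐ[k] K).comp i = i) (x : X) : (σ : K →ₐ[k] K).comp (ev x) = ev x := by
  classical
  have hπ := h.isPermutationQuotient hev
  have h1 := hπ.map_translate σ (Pi.single x 1)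
  rw [smul_torusCharacter_eq_self hE i σ hσ] at h1
  obtain ⟨c, hc⟩ := (hπ.map_eq_iff _ _).1 h1
  rw [← hev]
  congr 1
  by_contra hne
  -- If `σ` moved `x`, the indicator of `x` and its translate would differ by a constant equal to -1
  -- at `x` and to 1 at `σ • x`.
  have h2 := hc x
  have h3 := hc (σ • x)
  have h4 : σ⁻¹ • x ≠ x := fun h => hne ((inv_smul_eq_iff.1 h).symm)
  simp only [inv_smul_smul, Pi.single_eq_same, Pi.single_eq_of_ne hne,
    Pi.single_eq_of_ne h4] at h2 h3
  omega

end Coordinates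

/-! ### Products of Galois extensions -/

section Embeddings

variable {k : Type u} [Field k] {ι : Type} (F : ι → Type u) [∀ i, Field (F i)]
  [∀ i, Algebra k (F i)] (Ω : Type u) [Field Ω] [Algebra k Ω]

/-- The action of the Galois group of `Ω` on the embeddings of a family of fields in `Ω`. -/
abbrev embeddingAction : MulAction (Ω ≃ₐ[k] Ω) (Σ i, F i →ₐ[k] Ω) where
  smul σ x := ⟨x.1, (σ : Ω →ₐ[k] Ω).comp x.2⟩
  one_smul _ := rfl
  mul_smul _ _ _ := rfl

/-- The homomorphism from a product of fields given by an embedding of one of them. -/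
def piEmbedding (x : Σ i, F i →ₐ[k] Ω) : (∀ i, F i) →ₐ[k] Ω :=
  x.2.comp (Pi.evalAlgHom k F x.1)

theorem piEmbedding_injective : Function.Injective (piEmbedding (k := k) F Ω) := by
  classical
  rintro ⟨i, s⟩ ⟨j, t⟩ h
  have hij : i = j := by
    by_contra hij
    have h1 := DFunLike.congr_fun h (Pi.single i 1)
    change s (Pi.single (M := F) i 1 i) = t (Pi.single (M := F) i 1 j) at h1
    rw [Pi.single_eq_same, Pi.single_eq_of_ne (Ne.symm hij), map_one, map_zero] at h1
    exact one_ne_zero h1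
  subst hij
  congr 1
  ext y
  have h1 := DFunLike.congr_fun h (Pi.single i y)
  change s (Pi.single (M := F) i y i) = t (Pi.single (M := F) i y i) at h1
  rwa [Pi.single_eq_same] at h1

theorem isSplitBy_piEmbedding [Fintype ι] [∀ i, FiniteDimensional k (F i)] [∀ i, IsGalois k (F i)]
    (f : ∀ i, F i →ₐ[k] Ω) : IsSplitBy (piEmbedding (k := k) F Ω) where
  injective := piEmbedding_injective F Ω
  card := by
    rw [Fintype.card_sigma, Module.finrank_pi_fintype]
    refine Finset.sum_congr rfl fun i _ => AlgHom.card_of_splits k (F i) Ω fun x => ?_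
    have h := (Normal.splits' (F := k) (K := F i) x).map (f i : F i →+* Ω)
    rwa [Polynomial.map_map, (f i).comp_algebraMap] at h

end Embeddings

/-! ### The minimal splitting field is the compositum -/

section Galois

variable {k ks : Type u} [Field k] [Field ks] [Algebra k ks]

theorem IsCyclicPPower.isAbelianGalois {p : ℕ} {K P : IntermediateField k ks}
    (hK : IsCyclicPPower p k K) (hP : P ≤ K) : IsAbelianGalois k P := by
  have := hK.galois
  have := hK.cyclic
  have : IsAbelianGalois k K :=
    { is_comm := ⟨(IsCyclic.commGroup (α := K ≃ₐ[k] K)).mul_comm⟩ }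
  let _ : Algebra P K := (IntermediateField.inclusion hP).toRingHom.toAlgebra
  have : IsScalarTower k P K := IsScalarTower.of_algebraMap_eq fun _ => rfl
  exact IsAbelianGalois.tower_bot k P K

variable {n : ℕ} {P : Fin n → IntermediateField k ks} [∀ i, FiniteDimensional k (P i)]
  {E : IntermediateField k ks}

/-- A subfield of the separable closure that splits the norm torus of a product of Galois
extensions contains these extensions. -/
theorem le_of_splitsNormTorus [IsSepClosure k ks] [∀ i, IsGalois k (P i)]
    (hE : SplitsNormTorus k (∀ i, P i) E) (i : Fin n) : P i ≤ E := by
  intro y hy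
  have : IsGalois k ks := inferInstance
  rw [← InfiniteGalois.fixedField_fixingSubgroup E, IntermediateField.mem_fixedField_iff]
  intro σ hσ
  have hσ' : (σ : ks →ₐ[k] ks).comp E.val = E.val :=
    AlgHom.ext fun x => (IntermediateField.mem_fixingSubgroup_iff E σ).1 hσ x x.2
  let _ := embeddingAction (k := k) (fun i => P i) ks
  have h := (isSplitBy_piEmbedding (k := k) (fun i => P i) ks fun i => (P i).val).comp_eq_of_splits
    (fun _ _ => rfl) hE E.val σ hσ' ⟨i, (P i).val⟩
  -- Evaluate the fixed embedding at the element of the product with `i`-th coordinate `y` and zeros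
  -- elsewhere.
  have h1 := DFunLike.congr_fun h (fun j => if hj : i = j then (hj ▸ (⟨y, hy⟩ : P i)) else 0)
  simpa [piEmbedding] using h1

/-- A minimal Galois extension that splits the norm torus of a product of Galois extensions is
their compositum. -/
theorem IsMinimalGaloisSplitting.eq_iSup [IsSepClosure k ks] [∀ i, IsGalois k (P i)]
    (hE : IsMinimalGaloisSplitting k (∀ i, P i) E) : E = ⨆ i, P i := by
  have := hE.finite
  have hle : ⨆ i, P i ≤ E := iSup_le fun i => le_of_splitsNormTorus hE.splits i
  refine (IntermediateField.eq_of_le_of_finrank_le hle (hE.minimal _ inferInstance ?_ ?_)).symm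
  · have : Normal k (⨆ i, P i : IntermediateField k ks) := IntermediateField.normal_iSup k ks P
    exact ⟨⟩
  · exact (isSplitBy_piEmbedding (k := k) (fun i => P i) _ fun i =>
      IntermediateField.inclusion (le_iSup P i)).splitsNormTorus

end Galois

/-! ### Galois theory of a compositum of extensions of degree p -/

section Compositum

variable {k E : Type*} [Field k] [Field E] [Algebra k E] {ι : Type*}
  {Q : ι → IntermediateField k E}

theorem iInf_fixingSubgroup_eq_bot (hQ : ⨆ i, Q i = ⊤) : ⨅ i, (Q i).fixingSubgroup = ⊥ := by
  rw [eq_bot_iff, ← IntermediateField.fixingSubgroup_top, ← hQ, ← IntermediateField.le_iff_le,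
    iSup_le_iff]
  exact fun i => (IntermediateField.le_iff_le _ _).2 (iInf_le _ i)

/-- The stabilizer of an embedding of a normal subextension is its fixing subgroup. -/
theorem comp_eq_self_iff_mem_fixingSubgroup {F : Type*} [Field F] [Algebra k F]
    (q : IntermediateField k E) [Normal k q] (e : q ≃ₐ[k] F) (s : F →ₐ[k] E)
    (σ : E ≃ₐ[k] E) : (σ : E →ₐ[k] E).comp s = s ↔ σ ∈ q.fixingSubgroup := by
  have hr := AlgHom.fieldRange_of_normal (s.comp (e : q →ₐ[k] F))
  rw [IntermediateField.mem_fixingSubgroup_iff]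
  constructor
  · intro h x hx
    rw [← hr] at hx
    obtain ⟨y, rfl⟩ := hx
    exact DFunLike.congr_fun h (e y)
  · intro h
    ext y
    refine h (s y) ?_
    rw [← hr]
    exact ⟨e.symm y, congrArg s (e.apply_symm_apply y)⟩

variable {p : ℕ} [IsGalois k E] [∀ i, IsGalois k (Q i)]

/-- The Galois group of a compositum of Galois extensions of prime degree is commutative of
prime exponent. -/
theorem commute_and_pow_eq_one_of_iSup (hp : p.Prime) (hdeg : ∀ i, Module.finrank k (Q i) = p)
    (hQ : ⨆ i, Q i = ⊤) :
    (∀ σ τ : E ≃ₐ[k] E, σ * τ = τ * σ) ∧ ∀ σ : E ≃ₐ[k] E, σ ^ p = 1 := by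
  have : Fact p.Prime := ⟨hp⟩
  have hcard : ∀ i, Nat.card ((E ≃ₐ[k] E) ⧸ (Q i).fixingSubgroup) = p := fun i =>
    (IntermediateField.finrank_eq_fixingSubgroup_index E (Q i)).symm.trans (hdeg i)
  -- The group embeds in the product of its quotients by the fixing subgroups, which have order `p`;
  -- both claims are checked there.
  have key : ∀ σ : E ≃ₐ[k] E, (∀ i, σ ∈ (Q i).fixingSubgroup) → σ = 1 := fun σ h =>
    Subgroup.mem_bot.1 (iInf_fixingSubgroup_eq_bot hQ ▸ Subgroup.mem_iInf.2 h)
  constructor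
  · intro σ τ
    rw [← inv_mul_eq_one]
    refine key _ fun i => ?_
    have : IsCyclic ((E ≃ₐ[k] E) ⧸ (Q i).fixingSubgroup) := isCyclic_of_prime_card (hcard i)
    rw [← QuotientGroup.eq, QuotientGroup.mk_mul, QuotientGroup.mk_mul]
    exact (IsCyclic.commGroup (α := (E ≃ₐ[k] E) ⧸ (Q i).fixingSubgroup)).mul_comm _ _
  · intro σ
    refine key _ fun i => ?_
    rw [← QuotientGroup.eq_one_iff, QuotientGroup.mk_pow, ← hcard i]
    exact pow_card_eq_one'

end Compositum

/-! ### The theorem for norm tori -/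

theorem theorem8p10 {k ks : Type u} [Field k] [Field ks] [Algebra k ks] [IsSepClosure k ks]
    (p : ℕ) (hp : p.Prime) (n : ℕ)
    (K : Fin n → IntermediateField k ks) (hK : ∀ i, IsCyclicPPower p k (K i))
    (hdisj : Pairwise fun i j => K i ⊓ K j = ⊥)
    (P : Fin n → IntermediateField k ks) (hP : ∀ i, IsPrimPart p (K i) (P i))
    [∀ i, FiniteDimensional k (P i)]
    (E : IntermediateField k ks) (hE : IsMinimalGaloisSplitting k (∀ i, P i) E) :
    (¬ Nonempty ((E ≃ₐ[k] E) ≃* Multiplicative (ZMod p) × Multiplicative (ZMod p)) →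
      ShaTwoCycl (E ≃ₐ[k] E) (TorusCharacter k (∀ i, P i) E) = ⊥) ∧
    (Nonempty ((E ≃ₐ[k] E) ≃* Multiplicative (ZMod p) × Multiplicative (ZMod p)) →
      2 ≤ n ∧ Nonempty (ShaTwoCycl (E ≃ₐ[k] E) (TorusCharacter k (∀ i, P i) E) ≃+
        (Fin (n - 2) → ZMod p))) := by
  have : Fact p.Prime := ⟨hp⟩
  have := hE.finite
  have := hE.galois
  have hPab : ∀ i, IsAbelianGalois k (P i) := fun i => (hK i).isAbelianGalois (hP i).le
  have hPE : ∀ i, P i ≤ E := le_of_splitsNormTorus hE.splits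
  let Q : Fin n → IntermediateField k E := fun i => IntermediateField.restrict (hPE i)
  let e : ∀ i, P i ≃ₐ[k] Q i := fun i => IntermediateField.restrictAlgEquiv (hPE i)
  have hQgal : ∀ i, IsGalois k (Q i) := fun i => IsGalois.of_algEquiv (e i)
  have hQdeg : ∀ i, Module.finrank k (Q i) = p := fun i =>
    (e i).toLinearEquiv.finrank_eq.symm.trans (hP i).degree
  have hQtop : ⨆ i, Q i = ⊤ := by
    have h1 : E ≤ IntermediateField.lift (⨆ i, Q i) := by
      conv_lhs => rw [hE.eq_iSup]
      refine iSup_le fun i y hy => ?_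
      exact (IntermediateField.mem_lift (⟨y, hPE i hy⟩ : E)).2
        (le_iSup Q i ((IntermediateField.mem_restrict (hPE i) _).2 hy))
    exact eq_top_iff.2 fun x _ => (IntermediateField.mem_lift x).1 (h1 x.2)
  have hQinj : Function.Injective fun i => (Q i).fixingSubgroup := by
    intro i j hij
    by_contra hne
    have h1 : Q i = Q j := by
      rw [← IsGalois.fixedField_fixingSubgroup (Q i), ← IsGalois.fixedField_fixingSubgroup (Q j)]
      exact congrArg _ hij
    have h2 : P i = P j := by
      rw [← IntermediateField.lift_restrict (hPE i), ← IntermediateField.lift_restrict (hPE j)]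
      exact congrArg _ h1
    -- Only here does disjointness of the `K i` enter: a common subfield of degree `p` would lie in
    -- `K i ⊓ K j = ⊥`.
    have h3 : P i = ⊥ := le_bot_iff.1 (hdisj hne ▸ le_inf (hP i).le (h2 ▸ (hP j).le))
    have h4 := (hP i).degree
    rw [h3, IntermediateField.finrank_bot] at h4
    exact hp.one_lt.ne h4
  obtain ⟨hcomm, hexp⟩ := commute_and_pow_eq_one_of_iSup hp hQdeg hQtop
  let inst : CommGroup (E ≃ₐ[k] E) := { (inferInstance : Group (E ≃ₐ[k] E)) with mul_comm := hcomm }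
  let _ := embeddingAction (k := k) (fun i => P i) E
  have hsplit := isSplitBy_piEmbedding (k := k) (fun i => P i) E
    fun i => IntermediateField.inclusion (hPE i)
  refine shaTwoCycl_of_permutationQuotient (p := p) (G := E ≃ₐ[k] E)
    (X := Σ i, P i →ₐ[k] E) (s := Sigma.fst) (H := fun i => (Q i).fixingSubgroup)
    (hsplit.isPermutationQuotient fun _ _ => rfl) hexp (fun _ _ => rfl) ?_ ?_ ?_ hQinj
    (iInf_fixingSubgroup_eq_bot hQtop)
  · rintro σ ⟨i, s⟩
    rw [← comp_eq_self_iff_mem_fixingSubgroup (Q i) (e i).symm s]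
    exact ⟨fun h => eq_of_heq (Sigma.mk.inj_iff.1 h).2, fun h => Sigma.ext rfl (heq_of_eq h)⟩
  · exact fun i => ⟨⟨i, IntermediateField.inclusion (hPE i)⟩, rfl⟩
  · exact fun i => (IntermediateField.finrank_eq_fixingSubgroup_index E (Q i)).symm.trans (hQdeg i)
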